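/- Fix a computable enumeration $f_0,f_1,f_2,\dots$ of all polynomials with integer coefficients, in any finite number of variables. For a commutative ring $R$ let $\operatorname{HTP}(R)$ be the set of indices $e$ such that $f_e$ has a root all of whose coordinates lie in $R$. For a set $S$ of prime numbers let $\mathbb{Z}[S^{-1}]\subseteq\mathbb{Q}$ be the subring generated by the inverses of the elements of $S$, and let the lower density of $S$ be $\liminf_{n\to\infty}|S\cap\{q_1,\dots,q_n\}|/n$, where $q_1<q_2<\cdots$ are all the primes. A ring $R$ is computably presentable if there is a bijection from $R$ onto $\mathbb{N}$ under which the addition and the multiplication of $R$ become computable functions $\mathbb{N}\times\mathbb{N}\to\mathbb{N}$. Write $\leq_T$ and $\equiv_T$ for Turing reducibility and Turing equivalence of sets of natural numbers; a subring of $\mathbb{Q}$ is viewed as a set of natural numbers through a standard computable coding of the rational numbers. **Theorem.** For every computably enumerable set $B\subseteq\mathbb{N}$ with $\operatorname{HTP}(\mathbb{Q})\leq_T B$ there is a computably enumerable set $S$ of prime numbers, of lower density $0$, such that the ring $\mathbb{Z}[S^{-1}]$ is computably presentable and $$S\equiv_T \operatorname{HTP}(\mathbb{Z}[S^{-1}])\equiv_T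 B .$$ In particular, there is a computably enumerable set $S$ of prime numbers, of lower density $0$, such that the ring $R=\mathbb{Z}[S^{-1}]$ is computably presentable and $$R\equiv_T \operatorname{HTP}(R)\equiv_T \operatorname{HTP}(\mathbb{Q}).$$ -/

import Mathlib

noncomputable section

/-- The characteristic function of a set of natural numbers, as a (total) function usable as an
oracle. -/
def charFun (A : Set ℕ) : ℕ →. ℕ :=
  ((A.indicator 1 : ℕ → ℕ) : ℕ →. ℕ)

/-- `C ≤_T B` for sets of natural numbers: the characteristic function of `C` is computable with
the characteristic function of `B` as an oracle. -/
def SetTuringLE (C B : Set ℕ) : Prop :=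
  TuringReducible (charFun C) (charFun B)

/-- `C ≡_T B` for sets of natural numbers. -/
def SetTuringEquiv (C B : Set ℕ) : Prop :=
  SetTuringLE C B ∧ SetTuringLE B C

/-- A set of natural numbers is computably enumerable. -/
def IsCE (A : Set ℕ) : Prop :=
  REPred fun n => n ∈ A

/-- The polynomial in `ℤ[X₀, X₁, …]` described by a finite list of terms; the term `(c, [i, j, …])`
stands for `c * X i * X j * ⋯`, with indices repeated as often as needed. -/
def polyOfTerms (l : List (ℤ × List ℕ)) : MvPolynomial ℕ ℤ :=
  (l.map fun t => MvPolynomial.C t.1 * (t.2.map MvPolynomial.X).prod).sum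

/-- A computable enumeration `f₀, f₁, …` of all polynomials with integer coefficients, in any number
of variables: the index is decoded to a list of terms by the standard coding of lists, pairs and
integers. -/
def polyOfIndex (e : ℕ) : MvPolynomial ℕ ℤ :=
  polyOfTerms (Denumerable.ofNat (List (ℤ × List ℕ)) e)

/-- Every polynomial occurs in the enumeration. -/
theorem polyOfIndex_surjective : Function.Surjective polyOfIndex := by
  suffices h : ∀ p : MvPolynomial ℕ ℤ, ∃ l, polyOfTerms l = p by
    intro p
    obtain ⟨l, rfl⟩ := h p
    exact ⟨Encodable.encode l, by simp [polyOfIndex]⟩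
  intro p
  induction p using MvPolynomial.induction_on with
  | C a => exact ⟨[(a, [])], by simp [polyOfTerms]⟩
  | add p q hp hq =>
    obtain ⟨l, rfl⟩ := hp
    obtain ⟨m, rfl⟩ := hq
    exact ⟨l ++ m, by simp [polyOfTerms]⟩
  | mul_X p i hp =>
    obtain ⟨l, rfl⟩ := hp
    refine ⟨l.map fun t => (t.1, i :: t.2), ?_⟩
    induction l with
    | nil => simp [polyOfTerms]
    | cons t l ih =>
      simp only [polyOfTerms, List.map_cons, List.sum_cons, List.prod_cons, add_mul] at ih ⊢
      rw [ih]
      ring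

/-- Hilbert's Tenth Problem for `R`: the set of indices of polynomials with integer coefficients that
have a root with all coordinates in `R`. A polynomial only involves finitely many of the variables,
so assigning values to all of them is the same as giving a tuple of the appropriate length. -/
def HTP (R : Type*) [CommRing R] : Set ℕ :=
  {e | ∃ x : ℕ → R, MvPolynomial.aeval x (polyOfIndex e) = 0}

/-- The subring `ℤ[S⁻¹]` of `ℚ` generated by the inverses of the elements of `S`. -/
def invertPrimes (S : Set ℕ) : Subring ℚ :=
  Subring.closure ((fun p : ℕ => (p : ℚ)⁻¹) '' S)

/-- The rational number with index `n`: the index codes a numerator `a : ℤ` and a number `d : ℕ`,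
and the rational number is `a / (d + 1)`. -/
def ratOfIndex (n : ℕ) : ℚ :=
  ((Denumerable.ofNat (ℤ × ℕ) n).1 : ℚ) / ((Denumerable.ofNat (ℤ × ℕ) n).2 + 1)

/-- The membership problem of a subring of `ℚ`, as a set of indices of rational numbers. -/
def memberSet (R : Subring ℚ) : Set ℕ :=
  {n | ratOfIndex n ∈ R}

/-- A ring is computably presentable if it has a bijection with the natural numbers under which its
addition and multiplication become computable functions. -/
def ComputablyPresentable (R : Type*) [CommRing R] : Prop :=
  ∃ φ : R ≃ ℕ,
    Computable₂ (fun a b : ℕ => φ (φ.symm a + φ.symm b)) ∧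
    Computable₂ (fun a b : ℕ => φ (φ.symm a * φ.symm b))

open Classical in
/-- The lower density of a set `S` of primes: the lower limit of the proportion of elements of `S`
among the first `n` primes `q₁ < q₂ < ⋯ < qₙ` (here `Nat.nth Nat.Prime i` for `i < n`). -/
def lowerDensity (S : Set ℕ) : ℝ :=
  Filter.liminf
    (fun n : ℕ => (((Finset.range n).filter fun i => Nat.nth Nat.Prime i ∈ S).card : ℝ) / n)
    Filter.atTop

end

/-! The arithmetic ingredient is uniform. For odd squarefree `a` the rational numbers with
denominator prime to `a` form a diophantine subset of ℚ (`coprime_iff_exists_isQuaternary`), with a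
definition computable from `a`. Hence the existence of a zero with denominators prime to `a` reduces
computably to `HTP ℚ` (`exists_computable_semilocal_reduction`). The defining equations force
integrality by a descent at the primes dividing `a`; conversely they are solved with Legendre's
theorem and an auxiliary prime from Dirichlet's theorem.

The other ingredient is a priority construction. Before requirement `j` is treated, the state `(t,
a)` records that the first `t` primes are decided and that `a` is the product of those among them
that are never inverted. Requirement `2n` waits for `n` to enter `B`, requirement `2e + 1` for a
zero of `f_e` with denominators prime to `a`. If the event occurs at a stage `u ≥ t`, the primes
with indices in `[t, u]` are inverted, which is enough to put the zero found into the ring `R`. If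
it never occurs, `R` contains no zero, since the primes dividing `a` stay protected. So `e ∈ HTP(R)`
exactly when requirement `2e + 1` acts (`exists_mainRequirement_odd_iff`). After each requirement a
much longer block of primes is protected, which forces lower density 0. A late action swallows
everything that was enumerated on wrong guesses, so `S` is computably enumerable
(`mem_invertedIndices_iff`).

Which requirements act can be read off from `B` (odd ones through `HTP ℚ`), and also from `S`, by
asking whether the prime with index `t` was inverted. Either oracle therefore recovers the sequence
of states (`recursiveIn_state`), so `HTP(R) ≤ B` and `B ≤ S`; the reductions `S ≤ R ≤ HTP(R)` are
elementary and close the cycle. Computable presentability only needs `S` to be enumerable, because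
equality of fractions is decidable. -/

/-! ### Ternary quadratic forms and simultaneous representation of primes. -/

/-- **Legendre's theorem** on ternary forms, by the pigeonhole principle. -/
theorem exists_ternary_zero {a b c : ℕ} (ha : 0 < a) (hb : 0 < b) (hc : 0 < c)
    (hab : a.Coprime b) (hac : a.Coprime c) (hbc : b.Coprime c)
    (nab : ¬ IsSquare (a * b)) (nbc : ¬ IsSquare (b * c)) {s t u : ℤ}
    (hs : (a : ℤ) ∣ b * s ^ 2 - c) (ht : (b : ℤ) ∣ a * t ^ 2 - c) (hu : (c : ℤ) ∣ a * u ^ 2 + b) :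
    ∃ x y z : ℤ, ¬ (x = 0 ∧ y = 0 ∧ z = 0) ∧ a * x ^ 2 + b * y ^ 2 = c * z ^ 2 := by
  have : NeZero a := ⟨ha.ne'⟩
  have : NeZero b := ⟨hb.ne'⟩
  have : NeZero c := ⟨hc.ne'⟩
  -- The congruences `y ≡ sz (a)`, `x ≡ tz (b)`, `x ≡ uy (c)` cut out a lattice on which the form
  -- vanishes modulo `abc`. There are `abc` residue triples and more points in the box, so the
  -- difference of two box points lies in the lattice.
  let box := Finset.range ((b * c).sqrt + 1) ×ˢ Finset.range ((a * c).sqrt + 1) ×ˢ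
    Finset.range ((a * b).sqrt + 1)
  let f : ℕ × ℕ × ℕ → ZMod a × ZMod b × ZMod c := fun v =>
    ((v.2.1 : ZMod a) - (s : ZMod a) * v.2.2, (v.1 : ZMod b) - (t : ZMod b) * v.2.2,
      (v.1 : ZMod c) - (u : ZMod c) * v.2.1)
  have hcard : (Finset.univ : Finset (ZMod a × ZMod b × ZMod c)).card < box.card := by
    simp only [box, Finset.card_univ, Fintype.card_prod, ZMod.card, Finset.card_product,
      Finset.card_range]
    have h1 := Nat.lt_succ_sqrt' (b * c)
    have h2 := Nat.lt_succ_sqrt' (a * c)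
    have h3 := Nat.lt_succ_sqrt' (a * b)
    have h4 := Nat.mul_lt_mul'' h1 (Nat.mul_lt_mul'' h2 h3)
    rw [show b * c * (a * c * (a * b)) = (a * (b * c)) ^ 2 by ring, ← mul_pow, ← mul_pow] at h4
    exact lt_of_pow_lt_pow_left₀ 2 (Nat.zero_le _) h4
  obtain ⟨v, hv, w, hw, hne, hvw⟩ :=
    Finset.exists_ne_map_eq_of_card_lt_of_maps_to hcard (f := f) (fun _ _ => Finset.mem_univ _)
  obtain ⟨x₁, y₁, z₁⟩ := v
  obtain ⟨x₂, y₂, z₂⟩ := w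
  simp only [f, Prod.mk.injEq] at hvw
  simp only [box, Finset.mem_product, Finset.mem_range, Nat.lt_succ_iff] at hv hw
  obtain ⟨hA, hB, hC⟩ := hvw
  have key : ∀ {A B n : ℕ}, A ≤ n.sqrt → B ≤ n.sqrt → ((A : ℤ) - B) ^ 2 ≤ n := by
    intro A B n h1 h2
    have h3 : ((n.sqrt : ℕ) : ℤ) ^ 2 ≤ n := by exact_mod_cast Nat.sqrt_le' n
    refine le_trans ?_ h3
    have : (A : ℤ) ≤ n.sqrt := by exact_mod_cast h1
    have : (B : ℤ) ≤ n.sqrt := by exact_mod_cast h2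
    exact sq_le_sq' (by omega) (by omega)
  have hx := key hv.1 hw.1
  have hy := key hv.2.1 hw.2.1
  have hz := key hv.2.2 hw.2.2
  obtain ⟨x, hxd⟩ : ∃ x : ℤ, x = (x₁ : ℤ) - x₂ := ⟨_, rfl⟩
  obtain ⟨y, hyd⟩ : ∃ y : ℤ, y = (y₁ : ℤ) - y₂ := ⟨_, rfl⟩
  obtain ⟨z, hzd⟩ : ∃ z : ℤ, z = (z₁ : ℤ) - z₂ := ⟨_, rfl⟩
  rw [← hxd] at hx
  rw [← hyd] at hy
  rw [← hzd] at hz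
  have hA' : (a : ℤ) ∣ y - s * z := by
    rw [← ZMod.intCast_zmod_eq_zero_iff_dvd, hyd, hzd]
    push_cast
    linear_combination hA
  have hB' : (b : ℤ) ∣ x - t * z := by
    rw [← ZMod.intCast_zmod_eq_zero_iff_dvd, hxd, hzd]
    push_cast
    linear_combination hB
  have hC' : (c : ℤ) ∣ x - u * y := by
    rw [← ZMod.intCast_zmod_eq_zero_iff_dvd, hxd, hyd]
    push_cast
    linear_combination hC
  have hnz : ¬ (x = 0 ∧ y = 0 ∧ z = 0) := by
    rintro ⟨h1, h2, h3⟩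
    apply hne
    ext <;> simp only <;> omega
  have dA : (a : ℤ) ∣ a * x ^ 2 + b * y ^ 2 - c * z ^ 2 := by
    obtain ⟨k, hk⟩ := hA'
    obtain ⟨l, hl⟩ := hs
    exact ⟨x ^ 2 + l * z ^ 2 + b * k * (y + s * z), by linear_combination b * (y + s * z) * hk + z ^ 2 * hl⟩
  have dB : (b : ℤ) ∣ a * x ^ 2 + b * y ^ 2 - c * z ^ 2 := by
    obtain ⟨k, hk⟩ := hB'
    obtain ⟨l, hl⟩ := ht
    exact ⟨y ^ 2 + l * z ^ 2 + a * k * (x + t * z), by linear_combination a * (x + t * z) * hk + z ^ 2 * hl⟩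
  have dC : (c : ℤ) ∣ a * x ^ 2 + b * y ^ 2 - c * z ^ 2 := by
    obtain ⟨k, hk⟩ := hC'
    obtain ⟨l, hl⟩ := hu
    exact ⟨- z ^ 2 + l * y ^ 2 + a * k * (x + u * y), by linear_combination a * (x + u * y) * hk + y ^ 2 * hl⟩
  have cop : ∀ {m n : ℕ}, m.Coprime n → IsCoprime (m : ℤ) n := fun h => Nat.isCoprime_iff_coprime.2 h
  have d : (a * (b * c) : ℤ) ∣ a * x ^ 2 + b * y ^ 2 - c * z ^ 2 :=
    ((cop hab).mul_right (cop hac)).mul_dvd dA ((cop hbc).mul_dvd dB dC)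
  have hx' : x ^ 2 < b * c := by
    refine lt_of_le_of_ne (by exact_mod_cast hx) fun h => nbc ⟨x.natAbs, ?_⟩
    zify
    rw [← sq, sq_abs, h]
  have hz' : z ^ 2 < a * b := by
    refine lt_of_le_of_ne (by exact_mod_cast hz) fun h => nab ⟨z.natAbs, ?_⟩
    zify
    rw [← sq, sq_abs, h]
  have hy' : y ^ 2 ≤ a * c := by exact_mod_cast hy
  have pa : (0 : ℤ) < a := by exact_mod_cast ha
  have pb : (0 : ℤ) < b := by exact_mod_cast hb
  have pc : (0 : ℤ) < c := by exact_mod_cast hc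
  obtain ⟨k, hk⟩ := d
  have e1 : (a : ℤ) * x ^ 2 < a * (b * c) := mul_lt_mul_of_pos_left hx' pa
  have e2 : (b : ℤ) * y ^ 2 ≤ a * (b * c) := by
    linarith [mul_le_mul_of_nonneg_left hy' pb.le]
  have e3 : (c : ℤ) * z ^ 2 < a * (b * c) := by
    linarith [mul_lt_mul_of_pos_left hz' pc]
  have p : (0 : ℤ) < a * (b * c) := by positivity
  have e4 : (0 : ℤ) ≤ a * x ^ 2 := by positivity
  have e5 : (0 : ℤ) ≤ b * y ^ 2 := by positivity
  have e6 : (0 : ℤ) ≤ c * z ^ 2 := by positivity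
  -- The form has the value `k·abc`, and the bounds `x² < bc`, `y² ≤ ac`, `z² < ab` leave only `k =
  -- 0` and `k = 1`.
  have k1 : k < 2 := lt_of_mul_lt_mul_left (by linarith) p.le
  have k0 : -1 < k := lt_of_mul_lt_mul_left (by linarith) p.le
  obtain rfl | rfl : k = 0 ∨ k = 1 := by omega
  · exact ⟨x, y, z, hnz, by linear_combination hk⟩
  -- For `k = 1` one has `ax² + by² = c(z² + ab)`; multiply by `z² + ab` and use the composition
  -- identity `(ax² + by²)(z² + ab) = a(xz + by)² + b(yz - ax)²`.
  · refine ⟨x * z + b * y, y * z - a * x, z ^ 2 + a * b, fun h => ?_, ?_⟩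
    · have : (0 : ℤ) < a * b := by positivity
      nlinarith [h.2.2, sq_nonneg z]
    · linear_combination (z ^ 2 + a * b : ℤ) * hk

theorem not_isSquare_mul_prime {m p : ℕ} (hp : p.Prime) (h : ¬ p ∣ m) : ¬ IsSquare (m * p) := by
  rintro ⟨k, hk⟩
  have h1 : p ∣ k := by
    have : p ∣ k * k := hk ▸ Dvd.intro_left m rfl
    exact (hp.dvd_mul.1 this).elim id id
  obtain ⟨l, rfl⟩ := h1
  refine h ⟨l * l, Nat.eq_of_mul_eq_mul_right hp.pos ?_⟩
  rw [hk]
  ring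

/-- Quadratic reciprocity enters here, as periodicity of the Jacobi symbol in its lower argument. -/
theorem jacobiSym_eq_one_of_modEq (c : ℤ) {m : ℕ} (hm : Odd m) (h : m ≡ 1 [MOD 4 * c.natAbs]) :
    jacobiSym c m = 1 := by
  rw [jacobiSym.mod_right c hm, h, ← jacobiSym.mod_right c odd_one, jacobiSym.one_right]

theorem exists_mul_sq_modEq {r : ℕ} (hr : r.Prime) {c d : ℤ} (hc : ¬ (r : ℤ) ∣ c)
    (h : jacobiSym (c * d) r = 1) : ∃ u : ℤ, (r : ℤ) ∣ c * u ^ 2 - d := by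
  have : Fact r.Prime := ⟨hr⟩
  obtain ⟨y, hy⟩ := ZMod.isSquare_of_jacobiSym_eq_one h
  have hc0 : (c : ZMod r) ≠ 0 := by rwa [Ne, ZMod.intCast_zmod_eq_zero_iff_dvd]
  obtain ⟨u, hu⟩ := ZMod.intCast_surjective (y * (c : ZMod r)⁻¹)
  refine ⟨u, ?_⟩
  rw [← ZMod.intCast_zmod_eq_zero_iff_dvd]
  push_cast at hy ⊢
  rw [hu]
  field_simp
  linear_combination -hy

/-- A prime `r ≡ 1 mod 4a` is a norm from `ℚ(√a)`. -/
theorem exists_norm_eq_prime {a r : ℕ} (ha : 0 < a) (hsq : ¬ IsSquare a) (hr : r.Prime)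
    (h : r ≡ 1 [MOD 4 * a]) : ∃ x z : ℚ, x ^ 2 - a * z ^ 2 = r := by
  have hodd : Odd r := by
    have h4 : r % 4 = 1 := h.of_mul_right a
    exact Nat.odd_iff.2 (by omega)
  have hcop : a.Coprime r := by
    have : r.gcd a = 1 := by rw [(h.of_mul_left 4).gcd_eq, Nat.gcd_one_left]
    rwa [Nat.gcd_comm] at this
  have hnd : ¬ r ∣ a := fun hd => hr.one_lt.ne' (Nat.dvd_one.1 (hcop ▸ Nat.dvd_gcd hd dvd_rfl))
  obtain ⟨t, ht⟩ := exists_mul_sq_modEq hr (c := a) (d := 1) (by exact_mod_cast hnd)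
    (by rw [mul_one]; exact jacobiSym_eq_one_of_modEq _ hodd (by simpa using h))
  have hs : (a : ℤ) ∣ r * 1 ^ 2 - (1 : ℕ) := by
    have := (Nat.modEq_iff_dvd.1 (h.of_mul_left 4).symm)
    simpa using this
  -- Legendre's theorem for `a z² + r v² = x²`: `a` is a square modulo `r` by reciprocity, and `r ≡
  -- 1` modulo `a`.
  obtain ⟨z, v, x, hnz, he⟩ := exists_ternary_zero ha hr.pos one_pos hcop (Nat.coprime_one_right _)
    (Nat.coprime_one_right _) (not_isSquare_mul_prime hr hnd)
    (by simpa using not_isSquare_mul_prime hr (m := 1) (by simpa using hr.one_lt.ne'))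
    hs (t := t) (by simpa using ht) (u := 0) (by simp)
  have hv : v ≠ 0 := by
    rintro rfl
    have he' : (a : ℤ) * z ^ 2 = x ^ 2 := by simpa using he
    by_cases hz : z = 0
    · subst hz
      have : x = 0 := by simpa using he'.symm
      exact hnz ⟨rfl, rfl, this⟩
    · obtain ⟨w, rfl⟩ : z ∣ x := by
        rw [← Int.pow_dvd_pow_iff two_ne_zero, ← he']
        exact Dvd.intro_left _ rfl
      refine hsq ⟨w.natAbs, ?_⟩
      zify
      rw [← sq, sq_abs]
      refine mul_right_cancel₀ (pow_ne_zero 2 hz) ?_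
      rw [he']
      ring
  have he' : (a * z ^ 2 + r * v ^ 2 : ℚ) = x ^ 2 := by exact_mod_cast (by simpa using he)
  refine ⟨x / v, z / v, ?_⟩
  have hv' : (v : ℚ) ≠ 0 := by exact_mod_cast hv
  field_simp
  linear_combination -he'

/-- Legendre's theorem applies to `c w² + q y² = r v²`. The conditions at `c` and `q` are built into
the congruences for `r`; the one at `r` follows from `(c/q)(c/r) = (c/rq) = 1` and `(q/r) = (-1/r) =
1`. The conclusion `w ≠ 0` serves a later division by `w`. -/
theorem exists_binary_eq_prime {c : ℤ} {q r : ℕ} (hc : c ≠ 0) (hq : q.Prime) (hq4 : q % 4 = 1)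
    (hr : r.Prime) (hqc : ¬ (q : ℤ) ∣ c) (hrc : r * q ≡ 1 [MOD 4 * c.natAbs])
    (hrq : r ≡ 1 [MOD q]) {t : ℤ} (ht : (q : ℤ) ∣ c * t ^ 2 - 1) :
    ∃ w y : ℚ, w ≠ 0 ∧ c * w ^ 2 + q * y ^ 2 = r := by
  have hr4 : r % 4 = 1 := by
    have h4 : r * q % 4 = 1 := hrc.of_mul_right _
    rw [Nat.mul_mod, hq4, mul_one, Nat.mod_mod] at h4
    exact h4
  have hro : Odd r := Nat.odd_iff.2 (by omega)
  have hqo : Odd q := Nat.odd_iff.2 (by omega)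
  have : NeZero r := ⟨hr.ne_zero⟩
  have : NeZero q := ⟨hq.ne_zero⟩
  have hcq : jacobiSym c q = 1 := by
    have h1 : jacobiSym (c * t ^ 2) q = 1 := by
      have h2 : (1 : ℤ) % q = c * t ^ 2 % q := Int.modEq_iff_dvd.2 ht
      rw [jacobiSym.mod_left, ← h2, ← jacobiSym.mod_left, jacobiSym.one_left]
    rw [jacobiSym.mul_left, jacobiSym.pow_left] at h1
    have h3 : jacobiSym t q ≠ 0 := by
      intro h0
      rw [h0] at h1
      simp at h1
    rcases jacobiSym.trichotomy t q with h | h | h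
    · exact absurd h h3
    · simpa [h] using h1
    · simpa [h] using h1
  have hcr : jacobiSym c r = 1 := by
    have := jacobiSym_eq_one_of_modEq c (hro.mul hqo) hrc
    rwa [jacobiSym.mul_right, hcq, mul_one] at this
  have hqr : jacobiSym q r = 1 := by
    refine jacobiSym_eq_one_of_modEq _ hro ?_
    simp only [Int.natAbs_natCast]
    exact (Nat.modEq_and_modEq_iff_modEq_mul
      (by exact (Nat.Coprime.pow_left 2 (Nat.coprime_two_left.2 hqo) : Nat.Coprime (2 ^ 2) q))).1 ⟨hr4, hrq⟩
  have hnr : jacobiSym (-1) r = 1 := jacobiSym_eq_one_of_modEq _ hro hr4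
  have hrc' : ¬ (r : ℤ) ∣ c := by
    intro hd
    have h1 : r ∣ c.natAbs := Int.natCast_dvd.1 hd
    have h2 : r * q ≡ 1 [MOD r] := (hrc.of_mul_left 4).of_dvd h1
    have h3 : (r * q) % r = 1 % r := h2
    rw [Nat.mul_mod_right, Nat.mod_eq_of_lt hr.one_lt] at h3
    exact zero_ne_one h3
  have hrq' : r ≠ q := by
    rintro rfl
    have h3 : r % r = 1 % r := hrq
    rw [Nat.mod_self, Nat.mod_eq_of_lt hr.one_lt] at h3
    exact zero_ne_one h3
  obtain ⟨u, hu⟩ := exists_mul_sq_modEq hr (c := c) (d := -q) hrc' (by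
    rw [show c * -(q : ℤ) = -1 * c * q by ring, jacobiSym.mul_left, jacobiSym.mul_left, hnr, hcr, hqr]
    rfl)
  have cq : c.natAbs.Coprime q := by
    rw [Nat.coprime_comm, hq.coprime_iff_not_dvd]
    exact fun h => hqc (Int.natCast_dvd.2 h)
  have cr : c.natAbs.Coprime r := by
    rw [Nat.coprime_comm, hr.coprime_iff_not_dvd]
    exact fun h => hrc' (Int.natCast_dvd.2 h)
  have qr : q.Coprime r := (Nat.coprime_primes hq hr).2 hrq'.symm
  have hmod : c ∣ r * q - 1 := by
    have := Nat.modEq_iff_dvd.1 (hrc.of_mul_left 4).symm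
    rw [Int.natAbs_dvd] at this
    simpa using this
  have hrq1 : (q : ℤ) ∣ r - 1 := by simpa using Nat.modEq_iff_dvd.1 hrq.symm
  have hrd : ¬ r ∣ c.natAbs := fun h => hrc' (Int.natCast_dvd.2 h)
  have nqr : ¬ IsSquare (q * r) :=
    not_isSquare_mul_prime hr fun h => hrq' ((Nat.prime_dvd_prime_iff_eq hr hq).1 h)
  have main : ∃ w y v : ℤ, ¬ (w = 0 ∧ y = 0 ∧ v = 0) ∧ c * w ^ 2 + q * y ^ 2 = r * v ^ 2 := by
    rcases lt_or_gt_of_ne hc with hneg | hpos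
    -- For negative `c` the term moves to the other side, giving `|c| w² + r v² = q y²` with
    -- positive coefficients.
    · have habs : (c.natAbs : ℤ) = -c := by omega
      obtain ⟨w, v, y, hnz, he⟩ := exists_ternary_zero (Int.natAbs_pos.2 hc) hr.pos hq.pos cr cq
        qr.symm (not_isSquare_mul_prime hr hrd) (by rwa [mul_comm]) (s := q) (t := u) (u := t * r)
        (by
          rw [Int.natAbs_dvd]
          obtain ⟨k, hk⟩ := hmod
          exact ⟨k * q, by linear_combination (q : ℤ) * hk⟩)
        (by
          rw [habs]
          obtain ⟨k, hk⟩ := hu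
          exact ⟨-k, by linear_combination -hk⟩)
        (by
          rw [habs]
          obtain ⟨k, hk⟩ := ht
          obtain ⟨l, hl⟩ := hrq1
          exact ⟨-k * r ^ 2 - r * l, by linear_combination -(r : ℤ) ^ 2 * hk - (r : ℤ) * hl⟩)
      refine ⟨w, y, v, fun h => hnz ⟨h.1, h.2.2, h.2.1⟩, ?_⟩
      rw [habs] at he
      linear_combination -he
    · have habs : (c.natAbs : ℤ) = c := by omega
      have hqd : ¬ q ∣ c.natAbs := fun h => hqc (Int.natCast_dvd.2 h)
      obtain ⟨w, y, v, hnz, he⟩ := exists_ternary_zero (Int.natAbs_pos.2 hc) hq.pos hr.pos cq cr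
        qr (not_isSquare_mul_prime hq hqd) nqr (s := r) (t := t) (u := u)
        (by
          rw [habs]
          obtain ⟨k, hk⟩ := hmod
          exact ⟨k * r, by linear_combination (r : ℤ) * hk⟩)
        (by
          rw [habs]
          obtain ⟨k, hk⟩ := ht
          obtain ⟨l, hl⟩ := hrq1
          exact ⟨k - l, by linear_combination hk - hl⟩)
        (by rw [habs]; simpa using hu)
      rw [habs] at he
      exact ⟨w, y, v, hnz, he⟩
  obtain ⟨w, y, v, hnz, he⟩ := main
  -- The `p`-adic valuations of the two sides have different parity unless both vanish.
  have sqz : ∀ {p m : ℕ} {x z : ℤ}, p.Prime → ¬ p ∣ m → (m : ℤ) * x ^ 2 = p * z ^ 2 → x = 0 := by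
    intro p m x z hp hpm h
    by_contra hx
    have hm0 : m ≠ 0 := by rintro rfl; exact hpm (dvd_zero _)
    have hz : z ≠ 0 := by
      rintro rfl
      have : (m : ℤ) * x ^ 2 = 0 := by simpa using h
      rcases mul_eq_zero.1 this with h | h
      · exact hm0 (by exact_mod_cast h)
      · exact hx (pow_eq_zero_iff two_ne_zero |>.1 h)
    have h' : m * x.natAbs ^ 2 = p * z.natAbs ^ 2 := by zify; simpa using h
    have : Fact p.Prime := ⟨hp⟩
    have h2 := congrArg (padicValNat p) h'
    rw [padicValNat.mul hm0 (pow_ne_zero _ (Int.natAbs_ne_zero.2 hx)), padicValNat.mul hp.ne_zero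
      (pow_ne_zero _ (Int.natAbs_ne_zero.2 hz)), padicValNat.pow, padicValNat.pow, padicValNat_self,
      padicValNat.eq_zero_of_not_dvd hpm] at h2
    omega
  have hw : w ≠ 0 := by
    rintro rfl
    have hy : y = 0 := sqz hr (fun h => hrq' ((Nat.prime_dvd_prime_iff_eq hr hq).1 h)) (by simpa using he)
    subst hy
    have : v = 0 := by
      have : (r : ℤ) * v ^ 2 = 0 := by simpa using he.symm
      rcases mul_eq_zero.1 this with h | h
      · exact absurd (by exact_mod_cast h) hr.ne_zero
      · exact pow_eq_zero_iff two_ne_zero |>.1 h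
    exact hnz ⟨rfl, rfl, this⟩
  have hv : v ≠ 0 := by
    rintro rfl
    apply hw
    rcases lt_or_gt_of_ne hc with hneg | hpos
    · have habs : (c.natAbs : ℤ) = -c := by omega
      refine sqz (m := c.natAbs) (z := y) hq (fun h => hqc (Int.natCast_dvd.2 h)) ?_
      rw [habs]
      linear_combination -he
    · have : (0 : ℤ) < c * w ^ 2 := by positivity
      have : (0 : ℤ) ≤ q * y ^ 2 := by positivity
      simp at he
      omega
  have he' : (c * w ^ 2 + q * y ^ 2 : ℚ) = r * v ^ 2 := by exact_mod_cast he
  have hv' : (v : ℚ) ≠ 0 := by exact_mod_cast hv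
  have hw' : (w : ℚ) ≠ 0 := by exact_mod_cast hw
  refine ⟨w / v, y / v, div_ne_zero hw' hv', ?_⟩
  field_simp
  linear_combination he'

/-- The local-global step: a rational number whose denominator is coprime to `a` and `q` satisfies
the equation that cuts out integrality at the primes dividing `a`. -/
theorem exists_quaternary_of_coprime {a q : ℕ} (haodd : Odd a) (hsf : Squarefree a) (hq : q.Prime)
    (hq4 : q % 4 = 1) (hqa : ¬ q ∣ a) {x : ℚ} (hxa : x.den.Coprime a) (hxq : x.den.Coprime q) :
    ∃ X Y Z : ℚ, X ^ 2 - q * Y ^ 2 - a * Z ^ 2 + a * q * x ^ 2 = 1 := by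
  have ha : 0 < a := haodd.pos
  rcases eq_or_ne a 1 with rfl | ha1
  · exact ⟨1, x, 0, by push_cast; ring⟩
  have hasq : ¬ IsSquare a := by
    rintro ⟨k, rfl⟩
    have := Nat.isUnit_iff.1 (hsf k dvd_rfl)
    subst this
    exact ha1 rfl
  obtain ⟨n, hn⟩ : ∃ n, n = x.den := ⟨_, rfl⟩
  obtain ⟨m, hm⟩ : ∃ m, m = x.num := ⟨_, rfl⟩
  rw [← hn] at hxa hxq
  have hnpos : 0 < n := hn ▸ x.den_pos
  -- With `x = m/n` the equation reads `X² - aZ² - qY² = C/n²`. A prime `r` with both `r = x₁² - a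
  -- z₁²` and `r = C w² + q y²` solves it after division by `(nw)²`.
  obtain ⟨C, hC⟩ : ∃ C : ℤ, C = n ^ 2 - a * q * m ^ 2 := ⟨_, rfl⟩
  have hqn : ¬ q ∣ n := by
    rw [← hq.coprime_iff_not_dvd, Nat.coprime_comm]
    exact hxq
  have hqC : ¬ (q : ℤ) ∣ C := by
    intro h
    have h1 : (q : ℤ) ∣ n ^ 2 := by
      have := dvd_add h (Dvd.intro (a * m ^ 2) (by ring) : (q : ℤ) ∣ a * q * m ^ 2)
      rwa [hC, sub_add_cancel] at this
    exact hqn (hq.dvd_of_dvd_pow (by exact_mod_cast h1))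
  have hC0 : C ≠ 0 := by rintro rfl; exact hqC (dvd_zero _)
  have hCa : IsCoprime C a := by
    have h1 : IsCoprime ((n : ℤ) ^ 2) a := (Nat.isCoprime_iff_coprime.2 hxa).pow_left
    have h2 := h1.add_mul_left_left (-(q * m ^ 2))
    rwa [show (n : ℤ) ^ 2 + a * -(q * m ^ 2) = C by rw [hC]; ring] at h2
  have hCa' : C.natAbs.Coprime a := by
    exact Int.isCoprime_iff_gcd_eq_one.1 hCa
  have hCq' : C.natAbs.Coprime q := by
    rw [Nat.coprime_comm, hq.coprime_iff_not_dvd]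
    exact fun h => hqC (Int.natCast_dvd.2 h)
  have hqodd : Odd q := Nat.odd_iff.2 (by omega)
  have hqaodd : Odd (a * q) := haodd.mul hqodd
  have c4 : ∀ {k : ℕ}, Odd k → Nat.Coprime 4 k := fun h =>
    (Nat.Coprime.pow_left 2 (Nat.coprime_two_left.2 h) : Nat.Coprime (2 ^ 2) _)
  have hcop : (4 * C.natAbs).Coprime (a * q) :=
    (c4 hqaodd).mul_left (hCa'.mul_right hCq')
  have hcopq : q.Coprime (4 * C.natAbs) := hcop.coprime_mul_left_right.symm
  have hMpos : 0 < 4 * C.natAbs := by have := Int.natAbs_pos.2 hC0; omega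
  obtain ⟨q', hq'⟩ : ∃ q', q * q' ≡ 1 [MOD 4 * C.natAbs] := by
    have : NeZero (4 * C.natAbs) := ⟨hMpos.ne'⟩
    refine ⟨((q : ZMod (4 * C.natAbs))⁻¹).val, ?_⟩
    rw [← ZMod.natCast_eq_natCast_iff]
    push_cast
    rw [ZMod.natCast_zmod_val, ZMod.coe_mul_inv_eq_one _ hcopq]
  -- Both representations exist once `rq ≡ 1` modulo `4|C|` and `r ≡ 1` modulo `aq`; Dirichlet's
  -- theorem supplies such a prime.
  obtain ⟨k, hk1, hk2⟩ := Nat.chineseRemainder hcop q' 1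
  have hkq : k * q ≡ 1 [MOD 4 * C.natAbs] := by
    have := hk1.mul_right q
    rw [mul_comm q' q] at this
    exact this.trans hq'
  have cop_of : ∀ {u v : ℕ}, u ≡ 1 [MOD v] → u.Coprime v := fun {u v} h => by
    have := h.gcd_eq
    rwa [Nat.gcd_one_left] at this
  have hkcop : k.Coprime (4 * C.natAbs * (a * q)) :=
    (cop_of hkq).coprime_mul_right.mul_right (cop_of hk2)
  have : NeZero (4 * C.natAbs * (a * q)) := ⟨(Nat.mul_pos hMpos (Nat.mul_pos ha hq.pos)).ne'⟩
  obtain ⟨r, -, hr, hrk⟩ :=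
    Nat.forall_exists_prime_gt_and_eq_mod ((ZMod.isUnit_iff_coprime k _).2 hkcop) 0
  rw [ZMod.natCast_eq_natCast_iff] at hrk
  have hr1 : r * q ≡ 1 [MOD 4 * C.natAbs] := ((hrk.of_mul_right _).mul_right q).trans hkq
  have hr2 : r ≡ 1 [MOD a * q] := (hrk.of_mul_left _).trans hk2
  have hr4 : r % 4 = 1 := by
    have h4 : r * q % 4 = 1 := hr1.of_mul_right _
    rw [Nat.mul_mod, hq4, mul_one, Nat.mod_mod] at h4
    exact h4
  have hr4a : r ≡ 1 [MOD 4 * a] :=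
    (Nat.modEq_and_modEq_iff_modEq_mul (c4 haodd)).1 ⟨hr4, hr2.of_mul_right _⟩
  -- Modulo `q` the number `C` is `n²`, so an inverse of `n` works.
  obtain ⟨t, ht⟩ : ∃ t : ℤ, (q : ℤ) ∣ C * t ^ 2 - 1 := by
    obtain ⟨u, v, huv⟩ := Nat.isCoprime_iff_coprime.2 hxq
    refine ⟨u, ?_⟩
    rw [hC]
    exact ⟨-v * (1 + u * n) - a * m ^ 2 * u ^ 2, by linear_combination (1 + u * n) * huv⟩
  obtain ⟨x₁, z₁, h1⟩ := exists_norm_eq_prime ha hasq hr hr4a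
  obtain ⟨w, y, hw, h2⟩ := exists_binary_eq_prime hC0 hq hq4 hr hqC hr1 (hr2.of_mul_left _) ht
  have hn0 : (n : ℚ) ≠ 0 := by exact_mod_cast hnpos.ne'
  have hx : x * n = m := by rw [hn, hm]; exact Rat.mul_den_eq_num x
  have hCx : (C : ℚ) = n ^ 2 * (1 - a * q * x ^ 2) := by
    rw [hC]
    push_cast
    rw [← hx]
    ring
  rw [hCx] at h2
  refine ⟨x₁ / (n * w), y / (n * w), z₁ / (n * w), ?_⟩
  field_simp
  linear_combination h1 - h2

/-! ### Diophantine definition of integrality at finitely many primes. -/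

/-- The number `q` is a quadratic nonresidue modulo each divisor `d > 1` of `a`. -/
def NonresidueModDivisors (a q : ℕ) : Prop :=
  ∀ d < a + 1, 1 < d ∧ d ∣ a → ∀ y < d, y * y % d ≠ q % d

/-- Infinite descent on a common denominator `N`. If a prime `p` divides `N` and `a`, the equation
modulo `p` makes `u² - q v²` vanish, so `p` divides `u` and `v` as `q` is a nonresidue. Since `p²`
does not divide `a`, a factor `p` cancels and the same argument gives `p ∣ w, m`; then `N / p` is a
smaller common denominator. -/
theorem coprime_of_quaternary {a q : ℕ} (ha : 0 < a) (hsf : Squarefree a)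
    (h : NonresidueModDivisors a q) {x X Y Z : ℚ}
    (he : X ^ 2 - q * Y ^ 2 - a * Z ^ 2 + a * q * x ^ 2 = 1) : x.den.Coprime a := by
  have hex : ∃ N : ℕ, 0 < N ∧ ∃ m u v w : ℤ, (N : ℚ) * x = m ∧ N * X = u ∧ N * Y = v ∧ N * Z = w := by
    refine ⟨x.den * X.den * Y.den * Z.den, by positivity, x.num * X.den * Y.den * Z.den,
      x.den * X.num * Y.den * Z.den, x.den * X.den * Y.num * Z.den, x.den * X.den * Y.den * Z.num, ?_⟩
    push_cast
    rw [← Rat.mul_den_eq_num x, ← Rat.mul_den_eq_num X, ← Rat.mul_den_eq_num Y, ← Rat.mul_den_eq_num Z]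
    refine ⟨?_, ?_, ?_, ?_⟩ <;> ring
  classical
  have hspec := Nat.find_spec hex
  have hmin := fun k => Nat.find_min hex (m := k)
  generalize Nat.find hex = N at hspec hmin
  obtain ⟨hNpos, m, u, v, w, hm, hu, hv, hw⟩ := hspec
  have hint : u ^ 2 - q * v ^ 2 - a * w ^ 2 + a * q * m ^ 2 = (N : ℤ) ^ 2 := by
    have : (u : ℚ) ^ 2 - q * v ^ 2 - a * w ^ 2 + a * q * m ^ 2 = (N : ℚ) ^ 2 := by
      rw [← hm, ← hu, ← hv, ← hw]
      linear_combination (N : ℚ) ^ 2 * he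
    exact_mod_cast this
  have hden : x.den ∣ N := by
    have h1 : (x.den : ℤ) ∣ N * x.num := by
      refine ⟨m, ?_⟩
      have : (N : ℚ) * x.num = x.den * m := by
        rw [← hm, ← Rat.mul_den_eq_num x]
        ring
      exact_mod_cast this
    have h2 : IsCoprime (x.den : ℤ) x.num := by
      rw [Int.isCoprime_iff_gcd_eq_one, Int.gcd_comm]
      exact x.reduced
    exact_mod_cast h2.dvd_of_dvd_mul_right h1
  refine Nat.Coprime.coprime_dvd_left hden (Nat.coprime_of_dvd fun p hp hpN hpa => ?_)
  obtain ⟨b, rfl⟩ := hpa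
  have hpb : ¬ p ∣ b := by
    rintro ⟨d, rfl⟩
    exact hp.one_lt.ne' (Nat.isUnit_iff.1 (hsf p ⟨d, by ring⟩))
  have : Fact p.Prime := ⟨hp⟩
  have hnr := h p (Nat.lt_succ_of_le (Nat.le_of_dvd ha (Dvd.intro _ rfl))) ⟨hp.one_lt, Dvd.intro _ rfl⟩
  -- a norm from the unramified quadratic extension is divisible by `p` only if both coordinates are
  have aniso : ∀ s t : ℤ, (p : ℤ) ∣ s ^ 2 - q * t ^ 2 → (p : ℤ) ∣ s ∧ (p : ℤ) ∣ t := by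
    intro s t hst
    simp only [← ZMod.intCast_zmod_eq_zero_iff_dvd] at hst ⊢
    push_cast at hst
    by_cases ht : (t : ZMod p) = 0
    · rw [ht] at hst ⊢
      simpa using hst
    · exfalso
      refine hnr ((s / t : ZMod p)).val (ZMod.val_lt _) ?_
      rw [← Nat.ModEq, ← ZMod.natCast_eq_natCast_iff]
      push_cast
      rw [ZMod.natCast_zmod_val]
      field_simp
      linear_combination hst
  obtain ⟨N', rfl⟩ := hpN
  push_cast at hint hm hu hv hw
  obtain ⟨⟨u', rfl⟩, ⟨v', rfl⟩⟩ := aniso u v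
    ⟨p * N' ^ 2 + b * w ^ 2 - b * q * m ^ 2, by linear_combination hint⟩
  have hp0 : (p : ℤ) ≠ 0 := by exact_mod_cast hp.ne_zero
  have h3 : (p : ℤ) ∣ b * (w ^ 2 - q * m ^ 2) := by
    refine ⟨u' ^ 2 - q * v' ^ 2 - N' ^ 2, mul_left_cancel₀ hp0 ?_⟩
    linear_combination -hint
  obtain ⟨⟨w', rfl⟩, ⟨m', rfl⟩⟩ := aniso w m
    (((Nat.prime_iff_prime_int.1 hp).dvd_or_dvd h3).resolve_left fun h => hpb (by exact_mod_cast h))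
  have hN' : 0 < N' := Nat.pos_of_mul_pos_left hNpos
  have hpq : (p : ℚ) ≠ 0 := by exact_mod_cast hp.ne_zero
  push_cast at hm hu hv hw
  refine hmin N' (by nlinarith [hp.one_lt]) ⟨hN', m', u', v', w', ?_, ?_, ?_, ?_⟩ <;>
    refine mul_left_cancel₀ hpq ?_ <;> linarith

/-- The prime `q` can be used to define the ring of rational numbers integral at the prime divisors
of `a`. -/
def AdmissiblePrime (a q : ℕ) : Prop :=
  q.Prime ∧ q % 4 = 1 ∧ NonresidueModDivisors a q

/-- The numbers `x` for which the quaternary equation attached to `a` and `q` is solvable. -/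
def IsQuaternary (a q : ℕ) (x : ℚ) : Prop :=
  ∃ X Y Z : ℚ, X ^ 2 - q * Y ^ 2 - a * Z ^ 2 + a * q * x ^ 2 = 1

theorem AdmissiblePrime.not_dvd {a q : ℕ} (ha : 0 < a) (h : AdmissiblePrime a q) : ¬ q ∣ a := by
  intro hd
  refine h.2.2 q (Nat.lt_succ_of_le (Nat.le_of_dvd ha hd)) ⟨h.1.one_lt, hd⟩ 0 h.1.pos ?_
  simp

theorem Rat.den_intCast_div_natCast_dvd (m : ℤ) (d : ℕ) : ((m : ℚ) / d).den ∣ d := by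
  have := Rat.den_dvd m d
  rw [Rat.divInt_eq_div] at this
  exact_mod_cast this

/-- Partial fractions, splitting off the `q₁`-part of the denominator. Two auxiliary primes are used
because solvability of the equation for `q` was shown only for denominators prime to `q`. -/
theorem exists_add_of_coprime {a q₁ q₂ : ℕ} (h₁ : q₁.Prime) (h₂ : q₂.Prime) (hne : q₁ ≠ q₂)
    {x : ℚ} (hx : x.den.Coprime a) :
    ∃ y z : ℚ, x = y + z ∧ (y.den.Coprime a ∧ y.den.Coprime q₁) ∧
      (z.den.Coprime a ∧ z.den.Coprime q₂) := by
  obtain ⟨k, n, hn, hd⟩ := Nat.exists_eq_pow_mul_and_not_dvd x.den_ne_zero q₁ h₁.ne_one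
  have hcop : (q₁ ^ k).Coprime n := Nat.Coprime.pow_left k (h₁.coprime_iff_not_dvd.2 hn)
  obtain ⟨u, v, huv⟩ := Nat.isCoprime_iff_coprime.2 hcop
  have hn0 : n ≠ 0 := by rintro rfl; exact hn (dvd_zero _)
  have hq0 : q₁ ^ k ≠ 0 := pow_ne_zero _ h₁.ne_zero
  have den_dvd := Rat.den_intCast_div_natCast_dvd
  refine ⟨((x.num * u : ℤ) : ℚ) / n, ((x.num * v : ℤ) : ℚ) / (q₁ ^ k : ℕ), ?_,
    ⟨Nat.Coprime.coprime_dvd_left ((den_dvd _ _).trans (hd ▸ Dvd.intro_left _ rfl)) hx,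
      Nat.Coprime.coprime_dvd_left (den_dvd _ _) (Nat.coprime_comm.1 (h₁.coprime_iff_not_dvd.2 hn))⟩,
    ⟨Nat.Coprime.coprime_dvd_left ((den_dvd _ _).trans (hd ▸ Dvd.intro _ rfl)) hx,
      Nat.Coprime.coprime_dvd_left (den_dvd _ _)
        (Nat.Coprime.pow_left k ((Nat.coprime_primes h₁ h₂).2 hne))⟩⟩
  have hn0' : (n : ℚ) ≠ 0 := by exact_mod_cast hn0
  have hq0' : ((q₁ ^ k : ℕ) : ℚ) ≠ 0 := by exact_mod_cast hq0
  have huv' : (u * (q₁ ^ k : ℕ) + v * n : ℚ) = 1 := by exact_mod_cast huv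
  have hx' : x * ((q₁ ^ k : ℕ) * n) = x.num := by
    rw [← Nat.cast_mul, ← hd]
    exact Rat.mul_den_eq_num x
  generalize ((q₁ ^ k : ℕ) : ℚ) = P at *
  rw [Int.cast_mul, Int.cast_mul, ← hx']
  field_simp
  linear_combination -x * huv'

/-- The rational numbers that are integral at all primes dividing `a` form a diophantine set. -/
theorem coprime_iff_exists_isQuaternary {a q₁ q₂ : ℕ} (ha : Odd a) (hsf : Squarefree a)
    (h₁ : AdmissiblePrime a q₁) (h₂ : AdmissiblePrime a q₂) (hne : q₁ ≠ q₂) (x : ℚ) :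
    x.den.Coprime a ↔ ∃ y z, x = y + z ∧ IsQuaternary a q₁ y ∧ IsQuaternary a q₂ z := by
  constructor
  · intro hx
    obtain ⟨y, z, hxyz, hy, hz⟩ := exists_add_of_coprime h₁.1 h₂.1 hne hx
    exact ⟨y, z, hxyz,
      exists_quaternary_of_coprime ha hsf h₁.1 h₁.2.1 (h₁.not_dvd ha.pos) hy.1 hy.2,
      exists_quaternary_of_coprime ha hsf h₂.1 h₂.2.1 (h₂.not_dvd ha.pos) hz.1 hz.2⟩
  · rintro ⟨y, z, rfl, ⟨_, _, _, hy⟩, ⟨_, _, _, hz⟩⟩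
    exact Nat.Coprime.coprime_dvd_left (Rat.add_den_dvd y z)
      ((coprime_of_quaternary ha.pos hsf h₁.2.2 hy).mul_left
        (coprime_of_quaternary ha.pos hsf h₂.2.2 hz))

/-- Choose a nonresidue modulo each prime divisor of `a`, which exists because these primes are odd;
glue them with `1` modulo 4 and apply Dirichlet's theorem. -/
theorem exists_admissiblePrime {a : ℕ} (ha : Odd a) (N : ℕ) : ∃ q > N, AdmissiblePrime a q := by
  classical
  have hnr : ∀ p : ℕ, ∃ k : ℕ, p.Prime → Odd p → ¬ IsSquare (k : ZMod p) := by
    intro p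
    by_cases hp : p.Prime ∧ Odd p
    · have : Fact p.Prime := ⟨hp.1⟩
      obtain ⟨y, hy⟩ := FiniteField.exists_nonsquare (F := ZMod p) (by
        rw [ZMod.ringChar_zmod_n]
        rintro rfl
        exact absurd hp.2 (by decide))
      exact ⟨y.val, fun _ _ => by rwa [ZMod.natCast_zmod_val]⟩
    · exact ⟨0, fun h h' => absurd ⟨h, h'⟩ hp⟩
  choose f hf using hnr
  have hodd : ∀ {p : ℕ}, p ∣ a → Odd p := fun h => Odd.of_dvd_nat ha h
  obtain ⟨k, hk⟩ := Nat.chineseRemainderOfFinset f id a.primeFactors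
    (fun p hp => (Nat.prime_of_mem_primeFactors hp).ne_zero)
    (fun p hp q hq hpq => (Nat.coprime_primes (Nat.prime_of_mem_primeFactors hp)
      (Nat.prime_of_mem_primeFactors hq)).2 hpq)
  have hns : ∀ p : ℕ, p.Prime → p ∣ a → ¬ IsSquare (k : ZMod p) := by
    intro p hp hpa
    have h1 := hk p (Nat.mem_primeFactors.2 ⟨hp, hpa, ha.pos.ne'⟩)
    have h2 : (k : ZMod p) = f p := (ZMod.natCast_eq_natCast_iff _ _ _).2 h1
    rw [h2]
    exact hf p hp (hodd hpa)
  have hka : k.Coprime a := by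
    refine Nat.coprime_of_dvd fun p hp hpk hpa => hns p hp hpa ?_
    rw [(ZMod.natCast_eq_zero_iff k p).2 hpk]
    exact IsSquare.zero
  have c4 : Nat.Coprime a 4 :=
    (Nat.Coprime.pow_left 2 (Nat.coprime_two_left.2 ha) : Nat.Coprime (2 ^ 2) _).symm
  obtain ⟨l, hl1, hl2⟩ := Nat.chineseRemainder c4 k 1
  have hl : l.Coprime (a * 4) := by
    refine Nat.Coprime.mul_right ?_ ?_
    · rw [Nat.Coprime, hl1.gcd_eq]
      exact hka
    · rw [Nat.Coprime, hl2.gcd_eq]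
      rfl
  have : NeZero (a * 4) := ⟨by have := ha.pos; omega⟩
  obtain ⟨q, hqN, hq, hql⟩ :=
    Nat.forall_exists_prime_gt_and_eq_mod ((ZMod.isUnit_iff_coprime l _).2 hl) N
  rw [ZMod.natCast_eq_natCast_iff] at hql
  refine ⟨q, hqN, hq, (hql.of_mul_left a).trans hl2, ?_⟩
  rintro d - ⟨hd1, hda⟩ y - hy
  -- A square modulo `d` is a square modulo the least prime factor of `d`.
  have hpd : d.minFac ∣ d := Nat.minFac_dvd d
  refine hns d.minFac (Nat.minFac_prime hd1.ne') (hpd.trans hda) ⟨y, ?_⟩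
  have h1 : y * y ≡ q [MOD d.minFac] := Nat.ModEq.of_dvd hpd hy
  have h2 : q ≡ k [MOD d.minFac] := ((hql.of_mul_right 4).trans hl1).of_dvd (hpd.trans hda)
  have := (ZMod.natCast_eq_natCast_iff _ _ _).2 (h1.trans h2)
  push_cast at this
  exact this.symm

theorem exists_admissiblePrime_pair {a : ℕ} (ha : Odd a) :
    ∃ q₁ q₂, AdmissiblePrime a q₁ ∧ AdmissiblePrime a q₂ ∧ q₁ ≠ q₂ := by
  obtain ⟨q₁, -, h₁⟩ := exists_admissiblePrime ha 0
  obtain ⟨q₂, h, h₂⟩ := exists_admissiblePrime ha q₁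
  exact ⟨q₁, q₂, h₁, h₂, h.ne⟩

open Encodable

/-! ### Primitive recursive arithmetic of natural numbers and integers. -/

section PrimrecArithmetic

variable {α : Type*} [Primcodable α]

theorem PrimrecRel.forall_lt_of {R : ℕ → α → Prop} (hR : PrimrecRel R) {f : α → ℕ} (hf : Primrec f) :
    PrimrecPred fun a => ∀ x < f a, R x a :=
  (hR.forall_mem_list.comp (Primrec.list_range.comp hf) Primrec.id).of_eq fun a => by simp

theorem Primrec.nat_pow : Primrec₂ ((· ^ ·) : ℕ → ℕ → ℕ) :=
  Primrec₂.unpaired'.1 Nat.Primrec.pow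

theorem Primrec.nat_dvd : PrimrecRel ((· ∣ ·) : ℕ → ℕ → Prop) :=
  (Primrec.eq.comp (Primrec.nat_mod.comp Primrec.snd Primrec.fst) (Primrec.const 0)).of_eq
    fun _ => (Nat.dvd_iff_mod_eq_zero).symm

theorem Primrec.nat_prime : PrimrecPred Nat.Prime := by
  have h : PrimrecRel fun m p : ℕ => m ∣ p → m = 1 :=
    ((Primrec.nat_dvd.comp Primrec.fst Primrec.snd).not.or
      (Primrec.eq.comp Primrec.fst (Primrec.const 1))).of_eq fun a => by
        simp only [imp_iff_not_or]
  exact ((Primrec.nat_le.comp (Primrec.const 2) Primrec.id).and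
    (h.forall_lt_of Primrec.id)).of_eq fun p => Nat.prime_def_lt.symm

/-- The encoding of ℤ sends `n` to `2n` and `-(n + 1)` to `2n + 1`, so sign and size are read off by
parity and halving. -/
theorem Primrec.int_toNat : Primrec Int.toNat := by
  have h : Primrec fun z : ℤ => if encode z % 2 = 0 then encode z / 2 else 0 :=
    Primrec.ite (Primrec.eq.comp (Primrec.nat_mod.comp Primrec.encode (Primrec.const 2))
      (Primrec.const 0)) (Primrec.nat_div.comp Primrec.encode (Primrec.const 2)) (Primrec.const 0)
  refine h.of_eq fun z => ?_
  rcases z with n | n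
  · have : encode (Int.ofNat n) = 2 * n := rfl
    rw [this, if_pos (by omega), Int.toNat]
    omega
  · have : encode (Int.negSucc n) = 2 * n + 1 := rfl
    rw [this, if_neg (by omega), Int.toNat]

theorem Primrec.int_neg_toNat : Primrec fun z : ℤ => (-z).toNat := by
  have h : Primrec fun z : ℤ => if encode z % 2 = 0 then 0 else encode z / 2 + 1 :=
    Primrec.ite (Primrec.eq.comp (Primrec.nat_mod.comp Primrec.encode (Primrec.const 2))
      (Primrec.const 0)) (Primrec.const 0)
      (Primrec.succ.comp (Primrec.nat_div.comp Primrec.encode (Primrec.const 2)))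
  refine h.of_eq fun z => ?_
  rcases z with n | n
  · have : encode (Int.ofNat n) = 2 * n := rfl
    rw [this, if_pos (by omega)]
    simp
  · have : encode (Int.negSucc n) = 2 * n + 1 := rfl
    rw [this, if_neg (by omega), Int.neg_negSucc]
    simp only [Int.toNat_natCast]
    omega

/-- Integers are differences of their positive and negative parts; through this lemma the ring
operations of ℤ reduce to those of ℕ. -/
theorem Primrec.int_natCast_sub : Primrec₂ fun a b : ℕ => (a : ℤ) - b := by
  have h : Primrec fun p : ℕ × ℕ =>
      if p.2 ≤ p.1 then 2 * (p.1 - p.2) else 2 * (p.2 - p.1 - 1) + 1 :=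
    Primrec.ite (Primrec.nat_le.comp Primrec.snd Primrec.fst)
      (Primrec.nat_double.comp (Primrec.nat_sub.comp Primrec.fst Primrec.snd))
      (Primrec.nat_double_succ.comp (Primrec.nat_sub.comp (Primrec.nat_sub.comp Primrec.snd Primrec.fst)
        (Primrec.const 1)))
  refine Primrec₂.encode_iff.1 (h.of_eq fun p => ?_)
  obtain ⟨a, b⟩ := p
  simp only
  split_ifs with hle
  · rw [show (a : ℤ) - b = ((a - b : ℕ) : ℤ) by omega]
    rfl
  · rw [show (a : ℤ) - b = Int.negSucc (b - a - 1) by omega]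
    rfl

theorem Primrec.int_natCast : Primrec (Nat.cast : ℕ → ℤ) :=
  (Primrec.int_natCast_sub.comp Primrec.id (Primrec.const 0)).of_eq fun n => by simp

theorem Primrec.int_neg : Primrec (Neg.neg : ℤ → ℤ) :=
  (Primrec.int_natCast_sub.comp Primrec.int_neg_toNat Primrec.int_toNat).of_eq fun z => by omega

theorem Primrec.int_add : Primrec₂ ((· + ·) : ℤ → ℤ → ℤ) :=
  (Primrec.int_natCast_sub.comp
    (Primrec.nat_add.comp (Primrec.int_toNat.comp Primrec.fst) (Primrec.int_toNat.comp Primrec.snd))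
    (Primrec.nat_add.comp (Primrec.int_neg_toNat.comp Primrec.fst)
      (Primrec.int_neg_toNat.comp Primrec.snd))).of_eq fun p => by push_cast; omega

theorem Primrec.int_mul : Primrec₂ ((· * ·) : ℤ → ℤ → ℤ) :=
  (Primrec.int_natCast_sub.comp
    (Primrec.nat_add.comp
      (Primrec.nat_mul.comp (Primrec.int_toNat.comp Primrec.fst) (Primrec.int_toNat.comp Primrec.snd))
      (Primrec.nat_mul.comp (Primrec.int_neg_toNat.comp Primrec.fst)
        (Primrec.int_neg_toNat.comp Primrec.snd)))
    (Primrec.nat_add.comp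
      (Primrec.nat_mul.comp (Primrec.int_toNat.comp Primrec.fst)
        (Primrec.int_neg_toNat.comp Primrec.snd))
      (Primrec.nat_mul.comp (Primrec.int_neg_toNat.comp Primrec.fst)
        (Primrec.int_toNat.comp Primrec.snd)))).of_eq fun p => by
    obtain ⟨z, w⟩ := p
    have hz : z = z.toNat - (-z).toNat := by omega
    have hw : w = w.toNat - (-w).toNat := by omega
    simp only
    conv_rhs => rw [hz, hw]
    push_cast
    ring

end PrimrecArithmetic

/-! ### Counting functions and enumerable predicates. -/

section Computability

theorem ComputablePred.computable_count {p : ℕ → Prop} [DecidablePred p] (hp : ComputablePred p) :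
    Computable (Nat.count p) := by
  have h : Computable fun n : ℕ =>
      (Nat.rec 0 (fun k c => c + bif decide (p k) then 1 else 0) n : ℕ) :=
    Computable.nat_rec Computable.id (Computable.const 0)
      (Primrec.nat_add.to_comp.comp (Computable.snd.comp Computable.snd)
        (Computable.cond (hp.decide.comp (Computable.fst.comp Computable.snd))
          (Computable.const 1) (Computable.const 0))).to₂
  refine h.of_eq fun n => ?_
  induction n with
  | zero => simp
  | succ n ih =>
    rw [Nat.count_succ, ← ih]
    by_cases hn : p n <;> simp [hn]

/-- Search for the `m` satisfying `p` that has exactly `n` predecessors satisfying `p`. -/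
theorem ComputablePred.computable_nth {p : ℕ → Prop} (hp : ComputablePred p)
    (hinf : (Set.ofPred p).Infinite) : Computable (Nat.nth p) := by
  classical
  have hP : ComputablePred fun v : ℕ × ℕ => p v.2 ∧ Nat.count p v.2 = v.1 := by
    refine Computable.computablePred (p := fun v : ℕ × ℕ => p v.2 ∧ Nat.count p v.2 = v.1) ?_
    refine (Primrec.and.to_comp.comp (hp.decide.comp Computable.snd)
      (Primrec.eq.decide.to_comp.comp (hp.computable_count.comp Computable.snd)
        Computable.fst)).of_eq fun v => ?_
    simp
  have hex : ∀ n, ∃ m, p m ∧ Nat.count p m = n := fun n =>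
    ⟨Nat.nth p n, Nat.nth_mem_of_infinite hinf n, Nat.count_nth_of_infinite hinf n⟩
  refine (Computable.find (P := fun n m => p m ∧ Nat.count p m = n) hP hex).of_eq fun n => ?_
  have h := Nat.find_spec (hex n)
  conv_rhs => rw [← h.2]
  exact (Nat.nth_count h.1).symm

theorem computable_nth_prime : Computable (Nat.nth Nat.Prime) :=
  Primrec.nat_prime.computablePred.computable_nth Nat.infinite_setOfPred_prime

/-- Kleene's normal form: `r n c` says that a fixed program halts on `n` within the bound `c`. -/
theorem REPred.exists_primrec {p : ℕ → Prop} (hp : REPred p) :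
    ∃ r : ℕ → ℕ → Bool, Primrec₂ r ∧ ∀ n, p n ↔ ∃ c, r n c = true := by
  obtain ⟨code, hcode⟩ := Nat.Partrec.Code.exists_code.1
    (Partrec.nat_iff.1 (hp.map ((Computable.const 0).to₂)))
  refine ⟨fun n c => (Nat.Partrec.Code.evaln c code n).isSome, ?_, fun n => ?_⟩
  · exact Primrec.option_isSome.comp (Nat.Partrec.Code.primrec_evaln.comp
      (((Primrec.snd).pair (Primrec.const code)).pair Primrec.fst))
  · have h1 : p n ↔ (code.eval n).Dom := by
      rw [hcode]
      simp [Part.assert]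
    rw [h1, Part.dom_iff_mem]
    simp only [Nat.Partrec.Code.evaln_complete, Option.isSome_iff_exists, Option.mem_def]
    exact exists_comm

theorem REPred.of_exists_computable {α : Type*} [Primcodable α] {p : α → Prop} {r : α → ℕ → Bool}
    (hr : Computable₂ r) (h : ∀ a, p a ↔ ∃ c, r a c = true) : REPred p := by
  have h1 : Partrec fun a => Nat.rfind fun c => (Part.some (r a c) : Part Bool) :=
    Partrec.rfind hr.partrec
  refine h1.dom_re.of_eq fun a => ?_
  refine Nat.rfind_dom.trans ?_
  rw [h]
  simp only [Part.mem_some_iff]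
  constructor
  · rintro ⟨c, hc, -⟩
    exact ⟨c, hc.symm⟩
  · rintro ⟨c, hc⟩
    exact ⟨c, hc.symm, fun _ => trivial⟩

end Computability

/-! ### Polynomials as lists of terms and codes for their rational zeros. -/

section Terms

/-- The value at a rational point of the polynomial described by a list of terms. -/
def evalTerms (l : List (ℤ × List ℕ)) (x : ℕ → ℚ) : ℚ :=
  (l.map fun t => (t.1 : ℚ) * (t.2.map x).prod).sum

/-- The list of terms with a given index. -/
def termsOfIndex (e : ℕ) : List (ℤ × List ℕ) :=
  Denumerable.ofNat (List (ℤ × List ℕ)) e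

theorem aeval_polyOfTerms {R : Type*} [CommRing R] (φ : R →+* ℚ) (l : List (ℤ × List ℕ)) (x : ℕ → R) :
    φ (MvPolynomial.aeval x (polyOfTerms l)) = evalTerms l fun i => φ (x i) := by
  induction l with
  | nil => simp [polyOfTerms, evalTerms]
  | cons t l ih =>
    simp only [polyOfTerms, evalTerms, List.map_cons, List.sum_cons, map_add, map_mul] at ih ⊢
    rw [ih]
    congr 2
    · simp
    · simp [map_list_prod, Function.comp_def]

theorem mem_HTP_rat {e : ℕ} : e ∈ HTP ℚ ↔ ∃ x : ℕ → ℚ, evalTerms (termsOfIndex e) x = 0 :=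
  exists_congr fun x => by
    rw [polyOfIndex, ← termsOfIndex, ← RingHom.id_apply (MvPolynomial.aeval x _), aeval_polyOfTerms]
    rfl

theorem mem_HTP_subring {R : Subring ℚ} {e : ℕ} :
    e ∈ HTP R ↔ ∃ x : ℕ → ℚ, (∀ i, x i ∈ R) ∧ evalTerms (termsOfIndex e) x = 0 := by
  have h : ∀ x : ℕ → R, MvPolynomial.aeval x (polyOfIndex e) = 0 ↔
      evalTerms (termsOfIndex e) (fun i => (x i : ℚ)) = 0 := fun x => by
    rw [← map_eq_zero_iff R.subtype Subtype.val_injective, polyOfIndex, ← termsOfIndex,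
      aeval_polyOfTerms]
    rfl
  constructor
  · rintro ⟨x, hx⟩
    exact ⟨fun i => x i, fun i => (x i).2, (h x).1 hx⟩
  · rintro ⟨x, hR, hx⟩
    exact ⟨fun i => ⟨x i, hR i⟩, (h _).2 hx⟩

/-- A bound for the degree of a polynomial. -/
def degBound (l : List (ℤ × List ℕ)) : ℕ :=
  (l.map fun t => t.2.length).sum

/-- A bound for the variables of a polynomial. -/
def varBound (l : List (ℤ × List ℕ)) : ℕ :=
  (l.map fun t => t.2.sum).sum + 1

theorem length_le_degBound {l : List (ℤ × List ℕ)} {t : ℤ × List ℕ} (ht : t ∈ l) :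
    t.2.length ≤ degBound l :=
  List.single_le_sum (fun _ _ => Nat.zero_le _) _ (List.mem_map_of_mem ht)

theorem lt_varBound {l : List (ℤ × List ℕ)} {t : ℤ × List ℕ} (ht : t ∈ l) {i : ℕ} (hi : i ∈ t.2) :
    i < varBound l :=
  Nat.lt_succ_of_le ((List.single_le_sum (fun _ _ => Nat.zero_le _) _ hi).trans
    (List.single_le_sum (fun _ _ => Nat.zero_le _) _
      (List.mem_map_of_mem (f := fun t : ℤ × List ℕ => t.2.sum) ht)))

theorem evalTerms_congr {l : List (ℤ × List ℕ)} {x y : ℕ → ℚ} (h : ∀ i < varBound l, x i = y i) :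
    evalTerms l x = evalTerms l y := by
  unfold evalTerms
  congr 1
  refine List.map_congr_left fun t ht => ?_
  congr 2
  exact List.map_congr_left fun i hi => h i (lt_varBound ht hi)

/-- The numerator of the value of a polynomial at the point with coordinates `zᵢ / D`. -/
def evalNum (l : List (ℤ × List ℕ)) (z : List ℤ) (D : ℕ) : ℤ :=
  -- Each term is brought to the common denominator `D ^ degBound l`.
  (l.map fun t => t.1 * (t.2.map fun i => z.getD i 0).prod *
    ((D ^ (degBound l - t.2.length) : ℕ) : ℤ)).sum

theorem evalNum_eq (l : List (ℤ × List ℕ)) (z : List ℤ) {D : ℕ} (hD : D ≠ 0) :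
    (evalNum l z D : ℚ) = D ^ degBound l * evalTerms l fun i => (z.getD i 0 : ℚ) / D := by
  have hD' : (D : ℚ) ≠ 0 := by exact_mod_cast hD
  have hprod : ∀ m : List ℕ, ((m.map fun i => z.getD i 0).prod : ℤ) =
      (D : ℚ) ^ m.length * (m.map fun i => (z.getD i 0 : ℚ) / D).prod := by
    intro m
    induction m with
    | nil => simp
    | cons i m ih =>
      simp only [List.map_cons, List.prod_cons, List.length_cons, Int.cast_mul, ih]
      field_simp
      ring
  unfold evalNum evalTerms
  rw [Int.cast_list_sum, ← List.sum_map_mul_left, List.map_map]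
  congr 1
  refine List.map_congr_left fun t ht => ?_
  have hle := length_le_degBound ht
  simp only [Function.comp_apply, Int.cast_mul, hprod]
  generalize (t.2.map fun i => (z.getD i 0 : ℚ) / D).prod = P
  obtain ⟨k, hk⟩ := Nat.exists_eq_add_of_le hle
  rw [hk, Nat.add_sub_cancel_left, pow_add]
  push_cast
  ring

/-- The number `c` codes a rational zero of the polynomial with index `e`, with a common denominator
coprime to `a`. -/
def IsZeroCode (e a c : ℕ) : Prop :=
  (c.unpair.1 + 1).Coprime a ∧
    evalNum (termsOfIndex e) (Denumerable.ofNat (List ℤ) c.unpair.2) (c.unpair.1 + 1) = 0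

/-- The bound by `c + 1` matters for the construction: every prime in a denominator has an index
below `c`, so inverting the unprotected primes up to index `c` suffices. -/
theorem IsZeroCode.exists_zero {e a c : ℕ} (h : IsZeroCode e a c) :
    ∃ x : ℕ → ℚ, (∀ i, (x i).den.Coprime a ∧ (x i).den ≤ c + 1) ∧ evalTerms (termsOfIndex e) x = 0 := by
  have hD : c.unpair.1 + 1 ≠ 0 := Nat.succ_ne_zero _
  refine ⟨fun i => (((Denumerable.ofNat (List ℤ) c.unpair.2).getD i 0 : ℤ) : ℚ) /
    (c.unpair.1 + 1 : ℕ), fun i => ?_, ?_⟩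
  · have h2 := Rat.den_intCast_div_natCast_dvd ((Denumerable.ofNat (List ℤ) c.unpair.2).getD i 0)
      (c.unpair.1 + 1)
    exact ⟨Nat.Coprime.coprime_dvd_left h2 h.1, (Nat.le_of_dvd (Nat.succ_pos _) h2).trans
      (Nat.succ_le_succ (Nat.unpair_left_le c))⟩
  · have h1 := evalNum_eq (termsOfIndex e) (Denumerable.ofNat (List ℤ) c.unpair.2) hD
    rw [h.2, Int.cast_zero, zero_eq_mul] at h1
    exact h1.resolve_left (pow_ne_zero _ (by exact_mod_cast hD))

theorem exists_isZeroCode {e a : ℕ} {x : ℕ → ℚ} (hx : ∀ i, (x i).den.Coprime a)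
    (h : evalTerms (termsOfIndex e) x = 0) : ∃ c, IsZeroCode e a c := by
  obtain ⟨D, hD⟩ : ∃ D, D = ∏ i ∈ Finset.range (varBound (termsOfIndex e)), (x i).den := ⟨_, rfl⟩
  have hDpos : 0 < D := hD ▸ Finset.prod_pos fun i _ => (x i).den_pos
  have hDa : D.Coprime a := hD ▸ Nat.Coprime.prod_left fun i _ => hx i
  obtain ⟨z, hz⟩ : ∃ z : List ℤ, z = (List.range (varBound (termsOfIndex e))).map
    fun i => (x i * D).num := ⟨_, rfl⟩
  have hzx : ∀ i < varBound (termsOfIndex e), x i = (z.getD i 0 : ℚ) / D := by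
    intro i hi
    have hd : (x i).den ∣ D := hD ▸ Finset.dvd_prod_of_mem _ (Finset.mem_range.2 hi)
    obtain ⟨k, hk⟩ := hd
    have h1 : x i * D = ((x i).num * k : ℤ) := by
      rw [hk]
      push_cast
      rw [← mul_assoc, Rat.mul_den_eq_num]
    have h2 : z.getD i 0 = (x i).num * k := by
      rw [hz, List.getD_eq_getElem?_getD, List.getElem?_map, List.getElem?_range hi, Option.map_some,
        Option.getD_some, h1, Rat.num_intCast]
    have hD0 : (D : ℚ) ≠ 0 := by exact_mod_cast hDpos.ne'
    rw [eq_div_iff hD0, h2, h1]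
  -- The code stores `D - 1`, since `IsZeroCode` adds 1 to keep denominators positive.
  refine ⟨Nat.pair (D - 1) (encode z), ?_, ?_⟩
  · rwa [Nat.unpair_pair, Nat.sub_add_cancel hDpos]
  · rw [Nat.unpair_pair, Nat.sub_add_cancel hDpos]
    simp only [Denumerable.ofNat_encode]
    have h1 := evalNum_eq (termsOfIndex e) z hDpos.ne'
    rw [← evalTerms_congr hzx, h, mul_zero] at h1
    exact_mod_cast h1

end Terms

/-! ### Reduction of semilocal solvability to rational solvability. -/

section Reduction

/-- The product of two polynomials given by lists of terms. -/
def mulTerms (l m : List (ℤ × List ℕ)) : List (ℤ × List ℕ) :=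
  l.flatMap fun s => m.map fun t => (s.1 * t.1, s.2 ++ t.2)

theorem evalTerms_append (l m : List (ℤ × List ℕ)) (x : ℕ → ℚ) :
    evalTerms (l ++ m) x = evalTerms l x + evalTerms m x := by
  simp [evalTerms]

theorem evalTerms_cons (t : ℤ × List ℕ) (m : List (ℤ × List ℕ)) (x : ℕ → ℚ) :
    evalTerms (t :: m) x = t.1 * (t.2.map x).prod + evalTerms m x := by
  simp [evalTerms]

theorem evalTerms_nil (x : ℕ → ℚ) : evalTerms [] x = 0 := rfl

theorem evalTerms_mulTerms (l m : List (ℤ × List ℕ)) (x : ℕ → ℚ) :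
    evalTerms (mulTerms l m) x = evalTerms l x * evalTerms m x := by
  induction l with
  | nil => simp [mulTerms, evalTerms]
  | cons s l ih =>
    have h : mulTerms (s :: l) m = (m.map fun t => (s.1 * t.1, s.2 ++ t.2)) ++ mulTerms l m := rfl
    rw [h, evalTerms_append, ih, evalTerms_cons, add_mul]
    congr 1
    unfold evalTerms
    rw [← List.sum_map_mul_left, List.map_map]
    congr 1
    refine List.map_congr_left fun t _ => ?_
    simp only [Function.comp_apply, List.map_append, List.prod_append, Int.cast_mul]
    ring

/-- Substitution of `X₈ᵢ + X₈ᵢ₊₄` for the `i`-th variable. -/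
def substTerms (l : List (ℤ × List ℕ)) : List (ℤ × List ℕ) :=
  l.flatMap fun t =>
    t.2.foldr (fun i m => mulTerms [(1, [8 * i]), (1, [8 * i + 4])] m) [(t.1, [])]

theorem evalTerms_substTerms (l : List (ℤ × List ℕ)) (x : ℕ → ℚ) :
    evalTerms (substTerms l) x = evalTerms l fun i => x (8 * i) + x (8 * i + 4) := by
  have h : ∀ (c : ℤ) (m : List ℕ), evalTerms
      (m.foldr (fun i m => mulTerms [(1, [8 * i]), (1, [8 * i + 4])] m) [(c, [])]) x =
      c * (m.map fun i => x (8 * i) + x (8 * i + 4)).prod := by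
    intro c m
    induction m with
    | nil => simp [evalTerms]
    | cons i m ih =>
      rw [List.foldr_cons, evalTerms_mulTerms, ih]
      simp [evalTerms]
      ring
  induction l with
  | nil => rfl
  | cons t l ih =>
    have h1 : substTerms (t :: l) = t.2.foldr
      (fun i m => mulTerms [(1, [8 * i]), (1, [8 * i + 4])] m) [(t.1, [])] ++ substTerms l := rfl
    rw [h1, evalTerms_append, ih, h, evalTerms_cons]

/-- The equation defining integrality at the primes dividing `a`, for the variable with index `v`. -/
def quaternaryTerms (a q v : ℕ) : List (ℤ × List ℕ) :=
  [(1, [v + 1, v + 1]), (-(q : ℤ), [v + 2, v + 2]), (-(a : ℤ), [v + 3, v + 3]),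
    ((a * q : ℕ), [v, v]), (-1, [])]

theorem evalTerms_quaternaryTerms (a q v : ℕ) (x : ℕ → ℚ) :
    evalTerms (quaternaryTerms a q v) x =
      x (v + 1) ^ 2 - q * x (v + 2) ^ 2 - a * x (v + 3) ^ 2 + a * q * x v ^ 2 - 1 := by
  simp [quaternaryTerms, evalTerms]
  ring

/-- The sum of the squares of the two quaternary equations attached to the `i`-th variable. -/
def integralityTerms (a q₁ q₂ i : ℕ) : List (ℤ × List ℕ) :=
  mulTerms (quaternaryTerms a q₁ (8 * i)) (quaternaryTerms a q₁ (8 * i)) ++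
    mulTerms (quaternaryTerms a q₂ (8 * i + 4)) (quaternaryTerms a q₂ (8 * i + 4))

/-- The polynomial that has a rational zero if and only if the given polynomial has a zero that is
integral at the primes dividing `a`. -/
def semilocalTerms (l : List (ℤ × List ℕ)) (a q₁ q₂ : ℕ) : List (ℤ × List ℕ) :=
  mulTerms (substTerms l) (substTerms l) ++
    (List.range (varBound l)).flatMap fun i => integralityTerms a q₁ q₂ i

/-- Over the ordered field ℚ a sum of squares vanishes only if every square does, so one polynomial
expresses the whole system. -/
theorem evalTerms_semilocalTerms_eq_zero {l : List (ℤ × List ℕ)} {a q₁ q₂ : ℕ} {x : ℕ → ℚ} :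
    evalTerms (semilocalTerms l a q₁ q₂) x = 0 ↔
      (evalTerms l fun i => x (8 * i) + x (8 * i + 4)) = 0 ∧ ∀ i < varBound l,
        evalTerms (quaternaryTerms a q₁ (8 * i)) x = 0 ∧
          evalTerms (quaternaryTerms a q₂ (8 * i + 4)) x = 0 := by
  have h : ∀ m : List ℕ, evalTerms (m.flatMap fun i => integralityTerms a q₁ q₂ i) x =
      (m.map fun i => evalTerms (quaternaryTerms a q₁ (8 * i)) x ^ 2 +
        evalTerms (quaternaryTerms a q₂ (8 * i + 4)) x ^ 2).sum := by
    intro m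
    induction m with
    | nil => rfl
    | cons i m ih =>
      rw [List.flatMap_cons, evalTerms_append, ih, List.map_cons, List.sum_cons, integralityTerms,
        evalTerms_append, evalTerms_mulTerms, evalTerms_mulTerms, sq, sq]
  have hs : ∀ n : ℕ, ((List.range n).map fun i => evalTerms (quaternaryTerms a q₁ (8 * i)) x ^ 2 +
      evalTerms (quaternaryTerms a q₂ (8 * i + 4)) x ^ 2).sum = ∑ i ∈ Finset.range n,
      (evalTerms (quaternaryTerms a q₁ (8 * i)) x ^ 2 +
        evalTerms (quaternaryTerms a q₂ (8 * i + 4)) x ^ 2) := fun n => rfl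
  rw [semilocalTerms, evalTerms_append, evalTerms_mulTerms, evalTerms_substTerms, h, hs, ← sq,
    add_eq_zero_iff_of_nonneg (sq_nonneg _) (Finset.sum_nonneg fun i _ => by positivity),
    pow_eq_zero_iff two_ne_zero, Finset.sum_eq_zero_iff_of_nonneg fun i _ => by positivity]
  refine and_congr_right fun _ => forall_congr' fun i => ?_
  rw [Finset.mem_range, add_eq_zero_iff_of_nonneg (sq_nonneg _) (sq_nonneg _),
    pow_eq_zero_iff two_ne_zero, pow_eq_zero_iff two_ne_zero]

theorem exists_semilocalTerms_zero_iff {a q₁ q₂ : ℕ} (ha : Odd a) (hsf : Squarefree a)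
    (h₁ : AdmissiblePrime a q₁) (h₂ : AdmissiblePrime a q₂) (hne : q₁ ≠ q₂)
    (l : List (ℤ × List ℕ)) :
    (∃ x, evalTerms (semilocalTerms l a q₁ q₂) x = 0) ↔
      ∃ x : ℕ → ℚ, (∀ i, (x i).den.Coprime a) ∧ evalTerms l x = 0 := by
  simp only [evalTerms_semilocalTerms_eq_zero, evalTerms_quaternaryTerms]
  have key := coprime_iff_exists_isQuaternary ha hsf h₁ h₂ hne
  constructor
  · rintro ⟨x, h0, hx⟩
    -- Coordinates beyond `varBound l` are not controlled by the equations; they do not occur in `l`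
    -- and are reset to 0.
    refine ⟨fun i => if i < varBound l then x (8 * i) + x (8 * i + 4) else 0, fun i => ?_, ?_⟩
    · dsimp only
      split_ifs with hi
      · obtain ⟨h3, h4⟩ := hx i hi
        exact (key _).2 ⟨_, _, rfl, ⟨_, _, _, sub_eq_zero.1 h3⟩, ⟨_, _, _, sub_eq_zero.1 h4⟩⟩
      · simp
    · rw [← h0]
      exact evalTerms_congr fun i hi => if_pos hi
  · rintro ⟨x, hx, h0⟩
    choose y z hyz hy hz using fun i => (key (x i)).1 (hx i)
    choose Y₁ Y₂ Y₃ hY using hy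
    choose Z₁ Z₂ Z₃ hZ using hz
    -- Variable `i` owns the block `8i, …, 8i + 7`: a summand and its three auxiliary unknowns,
    -- twice.
    let w : ℕ → ℚ := fun n => match n % 8 with
      | 0 => y (n / 8) | 1 => Y₁ (n / 8) | 2 => Y₂ (n / 8) | 3 => Y₃ (n / 8)
      | 4 => z (n / 8) | 5 => Z₁ (n / 8) | 6 => Z₂ (n / 8) | _ => Z₃ (n / 8)
    have hw : ∀ i k, k < 8 → (8 * i + k) % 8 = k ∧ (8 * i + k) / 8 = i := fun i k hk => by omega
    have e0 : ∀ i, w (8 * i) = y i := fun i => by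
      have := hw i 0 (by norm_num)
      simp only [add_zero] at this
      simp only [w, this.1, this.2]
    have e1 : ∀ i, w (8 * i + 1) = Y₁ i := fun i => by simp only [w, hw i 1 (by norm_num)]
    have e2 : ∀ i, w (8 * i + 2) = Y₂ i := fun i => by simp only [w, hw i 2 (by norm_num)]
    have e3 : ∀ i, w (8 * i + 3) = Y₃ i := fun i => by simp only [w, hw i 3 (by norm_num)]
    have e4 : ∀ i, w (8 * i + 4) = z i := fun i => by simp only [w, hw i 4 (by norm_num)]
    have e5 : ∀ i, w (8 * i + 4 + 1) = Z₁ i := fun i => by simp only [w, hw i 5 (by norm_num)]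
    have e6 : ∀ i, w (8 * i + 4 + 2) = Z₂ i := fun i => by simp only [w, hw i 6 (by norm_num)]
    have e7 : ∀ i, w (8 * i + 4 + 3) = Z₃ i := fun i => by simp only [w, hw i 7 (by norm_num)]
    refine ⟨w, ?_, fun i _ => ?_⟩
    · simp only [e0, e4, ← hyz]
      exact h0
    · simp only [e0, e1, e2, e3, e4, e5, e6, e7]
      exact ⟨sub_eq_zero.2 (hY i), sub_eq_zero.2 (hZ i)⟩

end Reduction

/-! ### Computability of the reduction. -/

section PrimrecTerms

variable {α β : Type*} [Primcodable α] [Primcodable β]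

theorem Primrec.list_sum_nat : Primrec (List.sum : List ℕ → ℕ) :=
  Primrec.list_foldr Primrec.id (Primrec.const 0)
    (Primrec.nat_add.comp (Primrec.fst.comp Primrec.snd) (Primrec.snd.comp Primrec.snd)).to₂

theorem Primrec.list_sum_int : Primrec (List.sum : List ℤ → ℤ) :=
  Primrec.list_foldr Primrec.id (Primrec.const 0)
    (Primrec.int_add.comp (Primrec.fst.comp Primrec.snd) (Primrec.snd.comp Primrec.snd)).to₂

theorem Primrec.list_prod_int : Primrec (List.prod : List ℤ → ℤ) :=
  Primrec.list_foldr Primrec.id (Primrec.const 1)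
    (Primrec.int_mul.comp (Primrec.fst.comp Primrec.snd) (Primrec.snd.comp Primrec.snd)).to₂

theorem Primrec.list_prod_nat : Primrec (List.prod : List ℕ → ℕ) :=
  Primrec.list_foldr Primrec.id (Primrec.const 1)
    (Primrec.nat_mul.comp (Primrec.fst.comp Primrec.snd) (Primrec.snd.comp Primrec.snd)).to₂

theorem primrec_degBound : Primrec degBound :=
  Primrec.list_sum_nat.comp (Primrec.list_map Primrec.id
    (Primrec.list_length.comp (Primrec.snd.comp Primrec.snd)).to₂)

theorem primrec_varBound : Primrec varBound :=
  Primrec.succ.comp (Primrec.list_sum_nat.comp (Primrec.list_map Primrec.id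
    (Primrec.list_sum_nat.comp (Primrec.snd.comp Primrec.snd)).to₂))

theorem primrec_evalNum : Primrec fun v : List (ℤ × List ℕ) × List ℤ × ℕ => evalNum v.1 v.2.1 v.2.2 := by
  have h1 : Primrec fun w : (List (ℤ × List ℕ) × List ℤ × ℕ) × (ℤ × List ℕ) =>
      (w.2.2.map fun i => w.1.2.1.getD i 0).prod :=
    Primrec.list_prod_int.comp (Primrec.list_map (Primrec.snd.comp Primrec.snd)
      ((Primrec.list_getD 0).comp
        (Primrec.fst.comp (Primrec.snd.comp (Primrec.fst.comp Primrec.fst))) Primrec.snd).to₂)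
  have h2 : Primrec fun w : (List (ℤ × List ℕ) × List ℤ × ℕ) × (ℤ × List ℕ) =>
      ((w.1.2.2 ^ (degBound w.1.1 - w.2.2.length) : ℕ) : ℤ) :=
    Primrec.int_natCast.comp (Primrec.nat_pow.comp
      (Primrec.snd.comp (Primrec.snd.comp Primrec.fst))
      (Primrec.nat_sub.comp (primrec_degBound.comp (Primrec.fst.comp Primrec.fst))
        (Primrec.list_length.comp (Primrec.snd.comp Primrec.snd))))
  exact Primrec.list_sum_int.comp (Primrec.list_map Primrec.fst
    (Primrec.int_mul.comp (Primrec.int_mul.comp (Primrec.fst.comp Primrec.snd) h1) h2).to₂)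

theorem Primrec.nat_coprime : PrimrecRel Nat.Coprime := by
  have h : PrimrecRel fun (d : ℕ) (v : ℕ × ℕ) => d ∣ v.1 → d ∣ v.2 → d = 1 :=
    ((Primrec.nat_dvd.comp Primrec.fst (Primrec.fst.comp Primrec.snd)).not.or
      ((Primrec.nat_dvd.comp Primrec.fst (Primrec.snd.comp Primrec.snd)).not.or
        (Primrec.eq.comp Primrec.fst (Primrec.const 1)))).of_eq fun a => by
          simp only [imp_iff_not_or]
  refine (h.forall_lt_of (f := fun v : ℕ × ℕ => v.1 + v.2 + 2)
    (Primrec.succ.comp (Primrec.succ.comp (Primrec.nat_add.comp Primrec.fst Primrec.snd)))).of_eq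
    fun v => ?_
  obtain ⟨m, n⟩ := v
  constructor
  · intro h
    refine h (m.gcd n) ?_ (Nat.gcd_dvd_left m n) (Nat.gcd_dvd_right m n)
    by_cases hm : m = 0
    · subst hm
      simp
    · have := Nat.gcd_le_left n (Nat.pos_of_ne_zero hm)
      dsimp only
      omega
  · intro h d _ hm hn
    exact Nat.dvd_one.1 (h ▸ Nat.dvd_gcd hm hn)

theorem primrec_termsOfIndex : Primrec termsOfIndex :=
  Primrec.ofNat (List (ℤ × List ℕ))

theorem primrec_isZeroCode : PrimrecPred fun v : ℕ × ℕ × ℕ => IsZeroCode v.1 v.2.1 v.2.2 := by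
  have hc : Primrec fun v : ℕ × ℕ × ℕ => v.2.2.unpair :=
    Primrec.unpair.comp (Primrec.snd.comp Primrec.snd)
  have hD : Primrec fun v : ℕ × ℕ × ℕ => v.2.2.unpair.1 + 1 :=
    Primrec.succ.comp (Primrec.fst.comp hc)
  refine (Primrec.nat_coprime.comp hD (Primrec.fst.comp Primrec.snd)).and
    (Primrec.eq.comp (primrec_evalNum.comp ((primrec_termsOfIndex.comp Primrec.fst).pair
      (((Primrec.ofNat (List ℤ)).comp (Primrec.snd.comp hc)).pair hD))) (Primrec.const 0))

theorem primrec_mulTerms : Primrec₂ mulTerms := by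
  have h : Primrec₂ fun (p : List (ℤ × List ℕ) × List (ℤ × List ℕ)) (s : ℤ × List ℕ) =>
      p.2.map fun t => (s.1 * t.1, s.2 ++ t.2) :=
    (Primrec.list_map (Primrec.snd.comp Primrec.fst)
      ((Primrec.int_mul.comp (Primrec.fst.comp (Primrec.snd.comp Primrec.fst))
        (Primrec.fst.comp Primrec.snd)).pair
        (Primrec.list_append.comp (Primrec.snd.comp (Primrec.snd.comp Primrec.fst))
          (Primrec.snd.comp Primrec.snd))).to₂).to₂
  exact Primrec.list_flatMap Primrec.fst h

theorem Primrec.list_pair {f g : α → β} (hf : Primrec f) (hg : Primrec g) :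
    Primrec fun a => [f a, g a] :=
  Primrec.list_cons.comp hf (Primrec.list_cons.comp hg (Primrec.const []))

theorem primrec_substTerms : Primrec substTerms := by
  have h8 : Primrec fun w : (List (ℤ × List ℕ) × (ℤ × List ℕ)) × ℕ × List (ℤ × List ℕ) =>
      8 * w.2.1 := Primrec.nat_mul.comp (Primrec.const 8) (Primrec.fst.comp Primrec.snd)
  have hs : ∀ {f : (List (ℤ × List ℕ) × (ℤ × List ℕ)) × ℕ × List (ℤ × List ℕ) → ℕ}, Primrec f →
      Primrec fun w => ((1 : ℤ), [f w]) := fun hf =>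
    (Primrec.const 1).pair (Primrec.list_cons.comp hf (Primrec.const []))
  have h : Primrec₂ fun (_ : List (ℤ × List ℕ)) (t : ℤ × List ℕ) => t.2.foldr
      (fun i m => mulTerms [(1, [8 * i]), (1, [8 * i + 4])] m) [(t.1, [])] := by
    have hstep : Primrec fun w : (List (ℤ × List ℕ) × (ℤ × List ℕ)) × ℕ × List (ℤ × List ℕ) =>
        mulTerms [(1, [8 * w.2.1]), (1, [8 * w.2.1 + 4])] w.2.2 :=
      primrec_mulTerms.comp (Primrec.list_pair (hs h8)
        (hs (Primrec.nat_add.comp h8 (Primrec.const 4)))) (Primrec.snd.comp Primrec.snd)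
    have hinit : Primrec fun p : List (ℤ × List ℕ) × (ℤ × List ℕ) => [(p.2.1, ([] : List ℕ))] :=
      Primrec.list_cons.comp ((Primrec.fst.comp Primrec.snd).pair (Primrec.const []))
        (Primrec.const [])
    exact (Primrec.list_foldr (Primrec.snd.comp Primrec.snd) hinit hstep.to₂).to₂
  exact Primrec.list_flatMap Primrec.id h

theorem primrec_quaternaryTerms :
    Primrec fun v : ℕ × ℕ × ℕ => quaternaryTerms v.1 v.2.1 v.2.2 := by
  have hv : ∀ k : ℕ, Primrec fun v : ℕ × ℕ × ℕ => [v.2.2 + k, v.2.2 + k] := fun k =>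
    have := Primrec.nat_add.comp (Primrec.snd.comp (Primrec.snd (α := ℕ) (β := ℕ × ℕ)))
      (Primrec.const k)
    Primrec.list_pair this this
  have hq : Primrec fun v : ℕ × ℕ × ℕ => v.2.1 := Primrec.fst.comp Primrec.snd
  exact Primrec.list_cons.comp ((Primrec.const 1).pair (hv 1)) (Primrec.list_cons.comp
    ((Primrec.int_neg.comp (Primrec.int_natCast.comp hq)).pair (hv 2)) (Primrec.list_cons.comp
    ((Primrec.int_neg.comp (Primrec.int_natCast.comp Primrec.fst)).pair (hv 3)) (Primrec.list_cons.comp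
    ((Primrec.int_natCast.comp (Primrec.nat_mul.comp Primrec.fst hq)).pair (hv 0))
    (Primrec.const [(-1, [])]))))

theorem primrec_integralityTerms :
    Primrec fun v : ℕ × ℕ × ℕ × ℕ => integralityTerms v.1 v.2.1 v.2.2.1 v.2.2.2 := by
  have h8 : Primrec fun v : ℕ × ℕ × ℕ × ℕ => 8 * v.2.2.2 :=
    Primrec.nat_mul.comp (Primrec.const 8) (Primrec.snd.comp (Primrec.snd.comp Primrec.snd))
  have h1 : Primrec fun v : ℕ × ℕ × ℕ × ℕ => quaternaryTerms v.1 v.2.1 (8 * v.2.2.2) :=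
    primrec_quaternaryTerms.comp (Primrec.fst.pair ((Primrec.fst.comp Primrec.snd).pair h8))
  have h2 : Primrec fun v : ℕ × ℕ × ℕ × ℕ => quaternaryTerms v.1 v.2.2.1 (8 * v.2.2.2 + 4) :=
    primrec_quaternaryTerms.comp (Primrec.fst.pair
      ((Primrec.fst.comp (Primrec.snd.comp Primrec.snd)).pair
        (Primrec.nat_add.comp h8 (Primrec.const 4))))
  exact Primrec.list_append.comp (primrec_mulTerms.comp h1 h1) (primrec_mulTerms.comp h2 h2)

theorem primrec_semilocalTerms : Primrec fun v : List (ℤ × List ℕ) × ℕ × ℕ × ℕ =>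
    semilocalTerms v.1 v.2.1 v.2.2.1 v.2.2.2 := by
  have h1 : Primrec fun v : List (ℤ × List ℕ) × ℕ × ℕ × ℕ => substTerms v.1 :=
    primrec_substTerms.comp Primrec.fst
  have h2 : Primrec₂ fun (v : List (ℤ × List ℕ) × ℕ × ℕ × ℕ) (i : ℕ) =>
      integralityTerms v.2.1 v.2.2.1 v.2.2.2 i :=
    (primrec_integralityTerms.comp ((Primrec.fst.comp (Primrec.snd.comp Primrec.fst)).pair
      ((Primrec.fst.comp (Primrec.snd.comp (Primrec.snd.comp Primrec.fst))).pair
        ((Primrec.snd.comp (Primrec.snd.comp (Primrec.snd.comp Primrec.fst))).pair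
          Primrec.snd)))).to₂
  exact Primrec.list_append.comp (primrec_mulTerms.comp h1 h1)
    (Primrec.list_flatMap (Primrec.list_range.comp (primrec_varBound.comp Primrec.fst)) h2)

/-- All quantifiers in `NonresidueModDivisors` are bounded, which keeps the predicate primitive
recursive. -/
theorem primrec_admissiblePrime : PrimrecRel AdmissiblePrime := by
  have h1 : PrimrecRel fun (y : ℕ) (v : ℕ × ℕ × ℕ) => y * y % v.1 ≠ v.2.2 % v.1 :=
    (Primrec.eq.comp
      (Primrec.nat_mod.comp (Primrec.nat_mul.comp Primrec.fst Primrec.fst) (Primrec.fst.comp Primrec.snd))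
      (Primrec.nat_mod.comp (Primrec.snd.comp (Primrec.snd.comp Primrec.snd))
        (Primrec.fst.comp Primrec.snd))).not
  have h2 : PrimrecRel fun (d : ℕ) (v : ℕ × ℕ) => 1 < d ∧ d ∣ v.1 → ∀ y < d, y * y % d ≠ v.2 % d :=
    (((Primrec.nat_lt.comp (Primrec.const 1) Primrec.fst).and
      (Primrec.nat_dvd.comp Primrec.fst (Primrec.fst.comp Primrec.snd))).not.or
      (h1.forall_lt_of Primrec.fst)).of_eq fun a => imp_iff_not_or.symm
  exact (Primrec.nat_prime.comp Primrec.snd).and ((Primrec.eq.comp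
    (Primrec.nat_mod.comp Primrec.snd (Primrec.const 4)) (Primrec.const 1)).and
    (h2.forall_lt_of (Primrec.succ.comp Primrec.fst)))

theorem exists_computable_admissiblePrime_pair : ∃ f : ℕ → ℕ, Computable f ∧ ∀ a, Odd a →
    AdmissiblePrime a (f a).unpair.1 ∧ AdmissiblePrime a (f a).unpair.2 ∧
      (f a).unpair.1 ≠ (f a).unpair.2 := by
  classical
  have hu : Primrec fun v : ℕ × ℕ => v.2.unpair := Primrec.unpair.comp Primrec.snd
  -- The first alternative makes the search total by ending it at once for even `a`.
  have hP : PrimrecPred fun v : ℕ × ℕ => v.1 % 2 ≠ 1 ∨ AdmissiblePrime v.1 v.2.unpair.1 ∧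
      AdmissiblePrime v.1 v.2.unpair.2 ∧ v.2.unpair.1 ≠ v.2.unpair.2 :=
    (Primrec.eq.comp (Primrec.nat_mod.comp Primrec.fst (Primrec.const 2)) (Primrec.const 1)).not.or
      ((primrec_admissiblePrime.comp Primrec.fst (Primrec.fst.comp hu)).and
        ((primrec_admissiblePrime.comp Primrec.fst (Primrec.snd.comp hu)).and
          (Primrec.eq.comp (Primrec.fst.comp hu) (Primrec.snd.comp hu)).not))
  have hex : ∀ a : ℕ, ∃ n : ℕ, a % 2 ≠ 1 ∨ AdmissiblePrime a n.unpair.1 ∧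
      AdmissiblePrime a n.unpair.2 ∧ n.unpair.1 ≠ n.unpair.2 := by
    intro a
    by_cases ha : a % 2 = 1
    · obtain ⟨q₁, q₂, h⟩ := exists_admissiblePrime_pair (Nat.odd_iff.2 ha)
      exact ⟨Nat.pair q₁ q₂, Or.inr (by rwa [Nat.unpair_pair])⟩
    · exact ⟨0, Or.inl ha⟩
  refine ⟨_, Computable.find (P := fun a n : ℕ => a % 2 ≠ 1 ∨ AdmissiblePrime a n.unpair.1 ∧
      AdmissiblePrime a n.unpair.2 ∧ n.unpair.1 ≠ n.unpair.2) hP.computablePred hex, fun a ha => ?_⟩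
  exact (Nat.find_spec (hex a)).resolve_left fun h => h (Nat.odd_iff.1 ha)

/-- Solvability in a semilocal subring of `ℚ` is reducible to solvability in `ℚ`, uniformly. -/
theorem exists_computable_semilocal_reduction : ∃ g : ℕ → ℕ → ℕ, Computable₂ g ∧
    ∀ e a, Odd a → Squarefree a → (g e a ∈ HTP ℚ ↔ ∃ c, IsZeroCode e a c) := by
  obtain ⟨f, hf, hadm⟩ := exists_computable_admissiblePrime_pair
  refine ⟨fun e a => encode (semilocalTerms (termsOfIndex e) a (f a).unpair.1 (f a).unpair.2), ?_,
    fun e a ha hsf => ?_⟩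
  · have hu : Computable fun v : ℕ × ℕ => (f v.2).unpair :=
      Computable.unpair.comp (hf.comp Computable.snd)
    exact Computable.encode.comp (primrec_semilocalTerms.to_comp.comp
      ((primrec_termsOfIndex.to_comp.comp Computable.fst).pair (Computable.snd.pair
        ((Computable.fst.comp hu).pair (Computable.snd.comp hu)))))
  · obtain ⟨h₁, h₂, hne⟩ := hadm a ha
    have hdec : termsOfIndex (encode (semilocalTerms (termsOfIndex e) a (f a).unpair.1
        (f a).unpair.2)) = semilocalTerms (termsOfIndex e) a (f a).unpair.1 (f a).unpair.2 :=
      Denumerable.ofNat_encode _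
    rw [mem_HTP_rat, hdec, exists_semilocalTerms_zero_iff ha hsf h₁ h₂ hne]
    constructor
    · rintro ⟨x, hx, h⟩
      exact exists_isZeroCode hx h
    · rintro ⟨c, hc⟩
      obtain ⟨x, hx, h⟩ := hc.exists_zero
      exact ⟨x, fun i => (hx i).1, h⟩

end PrimrecTerms

/-! ### States of the construction. -/

/-- The product of the primes with indices `s, …, s + k - 1`. -/
noncomputable def primeProd (s k : ℕ) : ℕ :=
  Nat.rec 1 (fun i m => m * Nat.nth Nat.Prime (s + i)) k

theorem primeProd_succ (s k : ℕ) : primeProd s (k + 1) = primeProd s k * Nat.nth Nat.Prime (s + k) :=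
  rfl

theorem nth_prime_dvd_nth_prime {i j : ℕ} : Nat.nth Nat.Prime i ∣ Nat.nth Nat.Prime j ↔ i = j := by
  rw [Nat.prime_dvd_prime_iff_eq (Nat.prime_nth_prime i) (Nat.prime_nth_prime j)]
  exact (Nat.nth_injective Nat.infinite_setOfPred_prime).eq_iff

theorem nth_prime_dvd_primeProd {i s k : ℕ} :
    Nat.nth Nat.Prime i ∣ primeProd s k ↔ s ≤ i ∧ i < s + k := by
  induction k with
  | zero =>
    have : ¬ Nat.nth Nat.Prime i ∣ primeProd s 0 := (Nat.prime_nth_prime i).not_dvd_one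
    simp only [this, false_iff]
    omega
  | succ k ih =>
    rw [primeProd_succ, (Nat.prime_nth_prime i).dvd_mul, ih, nth_prime_dvd_nth_prime]
    omega

theorem exists_nth_prime_eq {p : ℕ} (hp : p.Prime) : ∃ i, Nat.nth Nat.Prime i = p :=
  ⟨_, Nat.nth_count hp⟩

theorem coprime_of_forall_nth_prime {m n : ℕ}
    (h : ∀ i, Nat.nth Nat.Prime i ∣ m → ¬ Nat.nth Nat.Prime i ∣ n) : m.Coprime n :=
  Nat.coprime_of_dvd fun p hp hm hn => by
    obtain ⟨i, rfl⟩ := exists_nth_prime_eq hp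
    exact h i hm hn

theorem squarefree_primeProd (s k : ℕ) : Squarefree (primeProd s k) := by
  induction k with
  | zero => exact squarefree_one
  | succ k ih =>
    rw [primeProd_succ, Nat.squarefree_mul_iff]
    refine ⟨coprime_of_forall_nth_prime fun i hi hk => ?_, ih, (Nat.prime_nth_prime _).squarefree⟩
    rw [nth_prime_dvd_primeProd] at hi
    rw [nth_prime_dvd_nth_prime] at hk
    omega

/-- The next state of the construction after stage `j`. A state `(t, a)` consists of the number `t`
of primes whose fate is decided and of the product `a` of those among them that are not inverted;
`s` is the least number such that the primes with indices in `[t, s)` become inverted. -/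
noncomputable def nextState (j s : ℕ) (σ : ℕ × ℕ) : ℕ × ℕ :=
  -- Indices from `s` up to the new bound are protected. The factor `j + 2` keeps the proportion of
  -- inverted primes below the bound under `1 / (j + 2)`.
  ((j + 2) * (s + 1), σ.2 * primeProd s ((j + 2) * (s + 1) - s))

/-- The sequence of states that belongs to a choice of the numbers `s`. -/
noncomputable def statePath (F : ℕ → ℕ × ℕ → ℕ) : ℕ → ℕ × ℕ
  -- The prime 2, with index 0, is decided from the start and not protected, so the protected
  -- product stays odd.
  | 0 => (1, 1)
  | j + 1 => nextState j (F j (statePath F j)) (statePath F j)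

theorem lt_nextState (j s : ℕ) (σ : ℕ × ℕ) : s < (nextState j s σ).1 := by
  show s < (j + 2) * (s + 1)
  nlinarith

theorem statePath_lt_succ {F : ℕ → ℕ × ℕ → ℕ} (hF : ∀ j σ, σ.1 ≤ F j σ) (j : ℕ) :
    F j (statePath F j) < (statePath F (j + 1)).1 ∧
      (statePath F j).1 < (statePath F (j + 1)).1 :=
  ⟨lt_nextState _ _ _, (hF _ _).trans_lt (lt_nextState _ _ _)⟩

theorem statePath_strictMono {F : ℕ → ℕ × ℕ → ℕ} (hF : ∀ j σ, σ.1 ≤ F j σ) :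
    StrictMono fun j => (statePath F j).1 :=
  strictMono_nat_of_lt_succ fun j => (statePath_lt_succ hF j).2

/-! ### The priority construction and its approximation by stages. -/

section Construction

variable (good : ℕ → ℕ → ℕ → Bool)

/-- The requirement `j` asks for attention at stage `u`. -/
def event (j : ℕ) (σ : ℕ × ℕ) (u : ℕ) : Bool :=
  -- Unpairing makes each candidate recur at arbitrarily late stages, so the condition `σ.1 ≤ u`
  -- loses none; moreover the candidate tested at stage `u` is at most `u`.
  decide (σ.1 ≤ u) && good j σ.2 u.unpair.1

open Classical in
/-- The end of the interval that requirement `j` puts into the set of inverted primes. -/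
noncomputable def intervalEnd (j : ℕ) (σ : ℕ × ℕ) : ℕ :=
  if h : ∃ u, event good j σ u = true then Nat.find h + 1 else σ.1

/-- The approximation at stage `s` to the end of the interval that requirement `j` puts into the set of
inverted primes. -/
def intervalEndAt (s j : ℕ) (σ : ℕ × ℕ) : ℕ :=
  -- The value `σ.1` means that no action has occurred, since acting at `u ≥ σ.1` sets it to `u +
  -- 1`. Later events are ignored.
  Nat.rec σ.1 (fun u r => bif decide (r = σ.1) && event good j σ u then u + 1 else r) s

theorem intervalEndAt_succ (s j : ℕ) (σ : ℕ × ℕ) : intervalEndAt good (s + 1) j σ =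
    bif decide (intervalEndAt good s j σ = σ.1) && event good j σ s then s + 1
      else intervalEndAt good s j σ :=
  rfl

theorem event_iff {j : ℕ} {σ : ℕ × ℕ} {u : ℕ} :
    event good j σ u = true ↔ σ.1 ≤ u ∧ good j σ.2 u.unpair.1 = true := by
  simp [event]

theorem exists_event_iff {j : ℕ} {σ : ℕ × ℕ} :
    (∃ u, event good j σ u = true) ↔ ∃ c, good j σ.2 c = true := by
  simp only [event_iff]
  constructor
  · rintro ⟨u, -, h⟩
    exact ⟨_, h⟩
  · rintro ⟨c, h⟩
    exact ⟨Nat.pair c σ.1, Nat.right_le_pair _ _, by rwa [Nat.unpair_pair]⟩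

theorem intervalEnd_cases (j : ℕ) (σ : ℕ × ℕ) :
    (∃ u, event good j σ u = true ∧ (∀ v < u, event good j σ v = false) ∧
      intervalEnd good j σ = u + 1 ∧ σ.1 ≤ u) ∨
      ((∀ u, event good j σ u = false) ∧ intervalEnd good j σ = σ.1) := by
  classical
  by_cases h : ∃ u, event good j σ u = true
  · refine Or.inl ⟨Nat.find h, Nat.find_spec h, fun v hv => ?_, dif_pos h,
      ((event_iff good).1 (Nat.find_spec h)).1⟩
    exact Bool.eq_false_iff.2 (Nat.find_min h hv)
  · refine Or.inr ⟨fun u => Bool.eq_false_iff.2 fun hu => h ⟨u, hu⟩, dif_neg h⟩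

theorem le_intervalEnd (j : ℕ) (σ : ℕ × ℕ) : σ.1 ≤ intervalEnd good j σ := by
  rcases intervalEnd_cases good j σ with ⟨u, -, -, h, hle⟩ | ⟨-, h⟩ <;> omega

/-- An action always inverts at least the first undecided prime, so nonemptiness of the interval
records whether the requirement acts. -/
theorem lt_intervalEnd_iff {j : ℕ} {σ : ℕ × ℕ} :
    σ.1 < intervalEnd good j σ ↔ ∃ c, good j σ.2 c = true := by
  rw [← exists_event_iff]
  rcases intervalEnd_cases good j σ with ⟨u, hu, -, h, hle⟩ | ⟨h', h⟩
  · exact ⟨fun _ => ⟨u, hu⟩, fun _ => by omega⟩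
  · refine ⟨fun h1 => by omega, fun ⟨u, hu⟩ => ?_⟩
    rw [h' u] at hu
    exact absurd hu (by decide)

/-- The approximation jumps at most once, just after the first event, and is then final. -/
theorem intervalEndAt_eq (s j : ℕ) (σ : ℕ × ℕ) : intervalEndAt good s j σ =
    if intervalEnd good j σ ≤ s then intervalEnd good j σ else σ.1 := by
  induction s with
  | zero =>
    have h0 : intervalEndAt good 0 j σ = σ.1 := rfl
    rw [h0]
    split_ifs with h
    · have := le_intervalEnd good j σ
      omega
    · rfl
  | succ s ih =>
    rw [intervalEndAt_succ, ih]
    rcases intervalEnd_cases good j σ with ⟨u, hu, hmin, h, hle⟩ | ⟨h', h⟩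
    · rw [h]
      rcases lt_trichotomy s u with hs | rfl | hs
      · rw [if_neg (by omega), if_neg (by omega), hmin s hs]
        simp
      · rw [if_neg (by omega), if_pos le_rfl, hu]
        simp
      · rw [if_pos (by omega), if_pos (by omega), decide_eq_false (by omega)]
        simp
    · rw [h, h' s]
      simp

theorem le_intervalEndAt (s j : ℕ) (σ : ℕ × ℕ) : σ.1 ≤ intervalEndAt good s j σ := by
  rw [intervalEndAt_eq]
  split_ifs
  · exact le_intervalEnd good j σ
  · exact le_rfl

/-- The state of the construction before requirement `j` is treated. -/
noncomputable def state (j : ℕ) : ℕ × ℕ :=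
  statePath (intervalEnd good) j

/-- The approximation at stage `s` to the state of the construction. -/
noncomputable def stateAt (s j : ℕ) : ℕ × ℕ :=
  statePath (intervalEndAt good s) j

/-- The indices of the primes that are inverted. -/
def invertedIndices : Set ℕ :=
  {i | i = 0 ∨ ∃ j, (state good j).1 ≤ i ∧ i < intervalEnd good j (state good j)}

theorem state_succ (j : ℕ) :
    state good (j + 1) = nextState j (intervalEnd good j (state good j)) (state good j) :=
  rfl

theorem stateAt_succ (s j : ℕ) : stateAt good s (j + 1) =
    nextState j (intervalEndAt good s j (stateAt good s j)) (stateAt good s j) :=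
  rfl

theorem state_strictMono : StrictMono fun j => (state good j).1 :=
  statePath_strictMono (le_intervalEnd good)

theorem intervalEnd_lt_state {k j : ℕ} (h : k < j) :
    intervalEnd good k (state good k) < (state good j).1 :=
  (lt_nextState _ _ _).trans_le ((state_strictMono good).monotone (Nat.succ_le_of_lt h))

theorem one_le_state (j : ℕ) : 1 ≤ (state good j).1 :=
  (state_strictMono good).monotone (Nat.zero_le j)

theorem notMem_invertedIndices {i j : ℕ} (h₁ : intervalEnd good j (state good j) ≤ i)
    (h₂ : i < (state good (j + 1)).1) : i ∉ invertedIndices good := by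
  have h3 := le_intervalEnd good j (state good j)
  have h4 := one_le_state good j
  rintro (rfl | ⟨k, hk1, hk2⟩)
  · omega
  rcases lt_trichotomy k j with h | rfl | h
  · have := intervalEnd_lt_state good h
    omega
  · omega
  · have : (state good (j + 1)).1 ≤ (state good k).1 :=
      (state_strictMono good).monotone (Nat.succ_le_of_lt h)
    omega

/-- The coding that makes `S` compute `B`: one membership question tells whether requirement `j`
acts. -/
theorem state_mem_invertedIndices_iff {j : ℕ} : (state good j).1 ∈ invertedIndices good ↔
    ∃ c, good j (state good j).2 c = true := by
  rw [← lt_intervalEnd_iff]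
  constructor
  · intro h
    by_contra hlt
    refine notMem_invertedIndices good (not_lt.1 hlt) (state_strictMono good (Nat.lt_succ_self j)) h
  · exact fun h => Or.inr ⟨j, le_rfl, h⟩

theorem nth_prime_dvd_state_iff {i j : ℕ} : Nat.nth Nat.Prime i ∣ (state good j).2 ↔
    i < (state good j).1 ∧ i ∉ invertedIndices good := by
  induction j with
  | zero =>
    have h1 : ¬ Nat.nth Nat.Prime i ∣ 1 := (Nat.prime_nth_prime i).not_dvd_one
    refine ⟨fun h => absurd h h1, fun ⟨h, h'⟩ => absurd (Or.inl ?_) h'⟩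
    have : i < 1 := h
    omega
  | succ j ih =>
    have hs := le_intervalEnd good j (state good j)
    have hlt := intervalEnd_lt_state good (Nat.lt_add_one j)
    have hsnd : (state good (j + 1)).2 = (state good j).2 * primeProd (intervalEnd good j (state good j))
      ((state good (j + 1)).1 - intervalEnd good j (state good j)) := rfl
    rw [hsnd, (Nat.prime_nth_prime i).dvd_mul, ih, nth_prime_dvd_primeProd]
    constructor
    · rintro (⟨h1, h2⟩ | ⟨h1, h2⟩)
      · exact ⟨by omega, h2⟩
      · exact ⟨by omega, notMem_invertedIndices good h1 (by omega)⟩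
    · rintro ⟨h1, h2⟩
      by_cases h3 : i < (state good j).1
      · exact Or.inl ⟨h3, h2⟩
      · refine Or.inr ⟨?_, by omega⟩
        by_contra h4
        exact h2 (Or.inr ⟨j, by omega, by omega⟩)

theorem odd_state (j : ℕ) : Odd (state good j).2 := by
  rw [← Nat.not_even_iff_odd, even_iff_two_dvd, ← Nat.nth_prime_zero_eq_two,
    nth_prime_dvd_state_iff]
  exact fun h => h.2 (Or.inl rfl)

theorem squarefree_state (j : ℕ) : Squarefree (state good j).2 := by
  induction j with
  | zero => exact squarefree_one
  | succ j ih =>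
    rw [state_succ, nextState, Nat.squarefree_mul_iff]
    refine ⟨coprime_of_forall_nth_prime fun i h1 h2 => ?_, ih, squarefree_primeProd _ _⟩
    rw [nth_prime_dvd_state_iff] at h1
    rw [nth_prime_dvd_primeProd] at h2
    have := le_intervalEnd good j (state good j)
    omega

/-- A prime whose index is small compared to a stage at which requirement `j` acts, and that is not
protected, is inverted. -/
theorem exists_good_of_mem {j : ℕ} (h : ∃ c, good j (state good j).2 c = true) :
    ∃ c, good j (state good j).2 c = true ∧
      ∀ i ≤ c, ¬ Nat.nth Nat.Prime i ∣ (state good j).2 → i ∈ invertedIndices good := by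
  rw [← lt_intervalEnd_iff] at h
  rcases intervalEnd_cases good j (state good j) with ⟨u, hu, -, he, hle⟩ | ⟨-, he⟩
  · refine ⟨u.unpair.1, ((event_iff good).1 hu).2, fun i hi hd => ?_⟩
    have := Nat.unpair_left_le u
    by_contra hni
    by_cases hit : i < (state good j).1
    · exact hd ((nth_prime_dvd_state_iff good).2 ⟨hit, hni⟩)
    · exact hni (Or.inr ⟨j, by omega, by omega⟩)
  · omega

/-- Once all earlier interval ends have been reached, the approximated state no longer changes. -/
theorem exists_forall_stateAt_eq (j : ℕ) : ∃ s₀, ∀ s ≥ s₀, stateAt good s j = state good j := by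
  induction j with
  | zero => exact ⟨0, fun _ _ => rfl⟩
  | succ j ih =>
    obtain ⟨s₀, h⟩ := ih
    refine ⟨s₀ + intervalEnd good j (state good j), fun s hs => ?_⟩
    rw [stateAt_succ, h s (by omega), intervalEndAt_eq, if_pos (by omega), state_succ]

/-- A wrong guess at stage `s` is due to an earlier requirement `k` that acts only later; its
interval then reaches beyond `s`. -/
theorem stateAt_eq_or (s j : ℕ) : stateAt good s j = state good j ∨
    ∃ k < j, (state good k).1 ≤ (stateAt good s j).1 ∧ s < intervalEnd good k (state good k) := by
  induction j with
  | zero => exact Or.inl rfl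
  | succ j ih =>
    have hlt := (statePath_lt_succ (le_intervalEndAt good s) j).2
    rcases ih with h | ⟨k, hk, h1, h2⟩
    · rcases le_or_gt (intervalEnd good j (state good j)) s with hs | hs
      · left
        rw [stateAt_succ, h, intervalEndAt_eq, if_pos hs, state_succ]
      · refine Or.inr ⟨j, Nat.lt_succ_self j, ?_, hs⟩
        rw [← h]
        exact hlt.le
    · exact Or.inr ⟨k, by omega, h1.trans hlt.le, h2⟩

/-- No index is enumerated wrongly: what a wrong guess at stage `s` inverts lies below `s` and above
the start of the late interval of `stateAt_eq_or`, hence inside that interval. -/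
theorem mem_invertedIndices_iff {i : ℕ} : i ∈ invertedIndices good ↔ i = 0 ∨ ∃ s j,
    (stateAt good s j).1 ≤ i ∧ i < intervalEndAt good s j (stateAt good s j) := by
  refine or_congr_right ⟨?_, ?_⟩
  · rintro ⟨j, h1, h2⟩
    obtain ⟨s₀, h⟩ := exists_forall_stateAt_eq good j
    refine ⟨s₀ + intervalEnd good j (state good j), j, ?_⟩
    rw [h _ (by omega), intervalEndAt_eq, if_pos (by omega)]
    exact ⟨h1, h2⟩
  · rintro ⟨s, j, h1, h2⟩
    rw [intervalEndAt_eq] at h2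
    split_ifs at h2 with hs
    · rcases stateAt_eq_or good s j with h | ⟨k, -, h3, h4⟩
      · rw [h] at h1 h2
        exact ⟨j, h1, h2⟩
      · exact ⟨k, by omega, by omega⟩
    · omega

/-- The primes that are inverted. -/
def invertedPrimes : Set ℕ :=
  Nat.nth Nat.Prime '' invertedIndices good

theorem nth_prime_mem_invertedPrimes {i : ℕ} :
    Nat.nth Nat.Prime i ∈ invertedPrimes good ↔ i ∈ invertedIndices good :=
  (Nat.nth_injective Nat.infinite_setOfPred_prime).mem_set_image

theorem prime_of_mem_invertedPrimes {p : ℕ} (hp : p ∈ invertedPrimes good) : p.Prime := by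
  obtain ⟨i, -, rfl⟩ := hp
  exact Nat.prime_nth_prime i

theorem lowerDensity_invertedPrimes : lowerDensity (invertedPrimes good) = 0 := by
  classical
  unfold lowerDensity
  simp only [nth_prime_mem_invertedPrimes]
  set f : ℕ → ℝ := fun n =>
    (((Finset.range n).filter fun i => i ∈ invertedIndices good).card : ℝ) / n with hf
  have hf0 : ∀ n, 0 ≤ f n := fun n => by positivity
  have hf1 : ∀ n, f n ≤ 1 := fun n => by
    refine div_le_one_of_le₀ ?_ (Nat.cast_nonneg n)
    exact_mod_cast (Finset.card_filter_le _ _).trans (Finset.card_range n).le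
  have hbdd : Filter.IsBoundedUnder (· ≥ ·) Filter.atTop f :=
    Filter.isBoundedUnder_of ⟨0, hf0⟩
  have hcobdd : Filter.IsCoboundedUnder (· ≥ ·) Filter.atTop f :=
    Filter.IsBoundedUnder.isCoboundedUnder_ge (Filter.isBoundedUnder_of ⟨1, hf1⟩)
  refine le_antisymm (le_of_forall_pos_le_add fun ε hε => ?_)
    (Filter.le_liminf_of_le hcobdd (Filter.Eventually.of_forall hf0))
  rw [zero_add]
  refine Filter.liminf_le_of_frequently_le ?_ hbdd
  obtain ⟨N, hN⟩ := exists_nat_one_div_lt hε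
  rw [Filter.frequently_atTop]
  intro M
  obtain ⟨j, hj⟩ : ∃ j, j = N + M := ⟨_, rfl⟩
  -- Density is sampled at the end of a protected block, where only indices below `s` can be
  -- inverted.
  refine ⟨(state good (j + 1)).1, ?_, ?_⟩
  · have := (state_strictMono good).le_apply (x := j + 1)
    omega
  · obtain ⟨s, hs⟩ : ∃ s, s = intervalEnd good j (state good j) := ⟨_, rfl⟩
    have hst : (state good (j + 1)).1 = (j + 2) * (s + 1) := by rw [state_succ, nextState, hs]
    have hcard : ((Finset.range (state good (j + 1)).1).filter
        fun i => i ∈ invertedIndices good).card ≤ s := by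
      conv_rhs => rw [← Finset.card_range s]
      refine Finset.card_le_card fun i hi => ?_
      rw [Finset.mem_filter, Finset.mem_range] at hi
      rw [Finset.mem_range]
      by_contra h
      exact notMem_invertedIndices good (hs ▸ not_lt.1 h) hi.1 hi.2
    refine le_trans ?_ hN.le
    show (_ : ℝ) / _ ≤ _
    have hj2 : ((N : ℝ) + 1) ≤ j + 2 := by
      rw [hj]
      push_cast
      have : (0 : ℝ) ≤ M := Nat.cast_nonneg M
      linarith
    rw [div_le_div_iff₀ (by rw [hst]; push_cast; positivity) (by positivity), hst]
    have hcard' : ((((Finset.range (state good (j + 1)).1).filter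
        fun i => i ∈ invertedIndices good).card : ℕ) : ℝ) ≤ s := by exact_mod_cast hcard
    rw [hst] at hcard'
    push_cast
    have hs0 : (0 : ℝ) ≤ s := Nat.cast_nonneg s
    calc _ ≤ (s : ℝ) * (N + 1) := mul_le_mul_of_nonneg_right hcard' (by positivity)
      _ ≤ (s + 1) * (j + 2) := mul_le_mul (by linarith) hj2 (by positivity) (by positivity)
      _ = 1 * ((j + 2) * (s + 1)) := by ring

end Construction

/-! ### Enumerability of the construction and following it with an oracle. -/

section ConstructionComputable

variable {good : ℕ → ℕ → ℕ → Bool}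

theorem computable_primeProd : Computable₂ primeProd :=
  (Computable.nat_rec (f := fun v : ℕ × ℕ => v.2) (g := fun _ => 1)
    (h := fun v w => w.2 * Nat.nth Nat.Prime (v.1 + w.1)) Computable.snd (Computable.const 1)
    (Primrec.nat_mul.to_comp.comp (Computable.snd.comp Computable.snd)
      (computable_nth_prime.comp (Primrec.nat_add.to_comp.comp (Computable.fst.comp Computable.fst)
        (Computable.fst.comp Computable.snd)))).to₂).of_eq fun _ => rfl

theorem computable_nextState : Computable fun v : ℕ × ℕ × ℕ × ℕ => nextState v.1 v.2.1 v.2.2 := by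
  have hs : Primrec fun v : ℕ × ℕ × ℕ × ℕ => v.2.1 := Primrec.fst.comp Primrec.snd
  have ht : Primrec fun v : ℕ × ℕ × ℕ × ℕ => (v.1 + 2) * (v.2.1 + 1) :=
    Primrec.nat_mul.comp (Primrec.nat_add.comp Primrec.fst (Primrec.const 2)) (Primrec.succ.comp hs)
  exact ht.to_comp.pair (Primrec.nat_mul.to_comp.comp
    (Primrec.snd.comp (Primrec.snd.comp Primrec.snd)).to_comp
    (computable_primeProd.comp hs.to_comp (Primrec.nat_sub.comp ht hs).to_comp))

theorem computable_event (hg : Computable fun v : ℕ × ℕ × ℕ => good v.1 v.2.1 v.2.2) :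
    Computable fun v : (ℕ × ℕ × ℕ) × ℕ => event good v.1.1 v.1.2 v.2 := by
  have hle : Primrec fun v : (ℕ × ℕ × ℕ) × ℕ => decide (v.1.2.1 ≤ v.2) :=
    (Primrec.nat_le.comp (Primrec.fst.comp (Primrec.snd.comp Primrec.fst)) Primrec.snd).decide
  have hgood : Computable fun v : (ℕ × ℕ × ℕ) × ℕ => good v.1.1 v.1.2.2 v.2.unpair.1 := by
    refine hg.comp (g := fun v : (ℕ × ℕ × ℕ) × ℕ => (v.1.1, v.1.2.2, v.2.unpair.1)) ?_
    exact ((Primrec.fst.comp Primrec.fst).pair ((Primrec.snd.comp (Primrec.snd.comp Primrec.fst)).pair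
      (Primrec.fst.comp (Primrec.unpair.comp Primrec.snd)))).to_comp
  exact Primrec.and.to_comp.comp hle.to_comp hgood

theorem computable_intervalEndAt (hg : Computable fun v : ℕ × ℕ × ℕ => good v.1 v.2.1 v.2.2) :
    Computable fun v : ℕ × ℕ × ℕ × ℕ => intervalEndAt good v.1 v.2.1 v.2.2 := by
  have h1 : Primrec fun w : (ℕ × ℕ × ℕ × ℕ) × ℕ × ℕ => decide (w.2.2 = w.1.2.2.1) :=
    (Primrec.eq.comp (Primrec.snd.comp Primrec.snd)
      (Primrec.fst.comp (Primrec.snd.comp (Primrec.snd.comp Primrec.fst)))).decide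
  have h2 : Computable fun w : (ℕ × ℕ × ℕ × ℕ) × ℕ × ℕ => event good w.1.2.1 w.1.2.2 w.2.1 := by
    refine (computable_event hg).comp (g := fun w : (ℕ × ℕ × ℕ × ℕ) × ℕ × ℕ => (w.1.2, w.2.1)) ?_
    exact ((Primrec.snd.comp Primrec.fst).pair (Primrec.fst.comp Primrec.snd)).to_comp
  have h3 : Computable fun w : (ℕ × ℕ × ℕ × ℕ) × ℕ × ℕ =>
      bif decide (w.2.2 = w.1.2.2.1) && event good w.1.2.1 w.1.2.2 w.2.1 then w.2.1 + 1
        else w.2.2 := by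
    refine Computable.cond ?_ ?_ ?_
    · exact Primrec.and.to_comp.comp h1.to_comp h2
    · exact (Primrec.succ.comp (Primrec.fst.comp Primrec.snd)).to_comp
    · exact (Primrec.snd.comp Primrec.snd).to_comp
  have h4 := (Computable.nat_rec (f := fun v : ℕ × ℕ × ℕ × ℕ => v.1) (g := fun v => v.2.2.1)
    (h := fun v w => bif decide (w.2 = v.2.2.1) && event good v.2.1 v.2.2 w.1 then w.1 + 1 else w.2)
    Computable.fst (Primrec.fst.comp (Primrec.snd.comp Primrec.snd)).to_comp h3.to₂)
  exact h4.of_eq fun _ => rfl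

theorem computable_stateAt (hg : Computable fun v : ℕ × ℕ × ℕ => good v.1 v.2.1 v.2.2) :
    Computable₂ (stateAt good) := by
  have h1 : Computable fun w : (ℕ × ℕ) × ℕ × ℕ × ℕ => intervalEndAt good w.1.1 w.2.1 w.2.2 := by
    refine (computable_intervalEndAt hg).comp
      (g := fun w : (ℕ × ℕ) × ℕ × ℕ × ℕ => (w.1.1, w.2)) ?_
    exact ((Primrec.fst.comp Primrec.fst).pair Primrec.snd).to_comp
  have h2 : Computable fun w : (ℕ × ℕ) × ℕ × ℕ × ℕ =>
      nextState w.2.1 (intervalEndAt good w.1.1 w.2.1 w.2.2) w.2.2 := by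
    refine computable_nextState.comp (g := fun w : (ℕ × ℕ) × ℕ × ℕ × ℕ =>
      (w.2.1, intervalEndAt good w.1.1 w.2.1 w.2.2, w.2.2)) ?_
    exact (Computable.fst.comp Computable.snd).pair (h1.pair (Computable.snd.comp Computable.snd))
  have h3 := Computable.nat_rec (f := fun v : ℕ × ℕ => v.2) (g := fun _ => ((1, 1) : ℕ × ℕ))
    (h := fun v w => nextState w.1 (intervalEndAt good v.1 w.1 w.2) w.2)
    Computable.snd (Computable.const (1, 1)) h2.to₂
  refine h3.of_eq fun v => ?_
  obtain ⟨s, j⟩ := v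
  induction j with
  | zero => rfl
  | succ j ih =>
    dsimp only at ih ⊢
    rw [stateAt_succ, ← ih]

theorem isCE_invertedPrimes (hg : Computable fun v : ℕ × ℕ × ℕ => good v.1 v.2.1 v.2.2) :
    IsCE (invertedPrimes good) := by
  classical
  have hu : Primrec fun v : ℕ × ℕ => v.2.unpair.2.unpair :=
    Primrec.unpair.comp (Primrec.snd.comp (Primrec.unpair.comp Primrec.snd))
  have hi : Primrec fun v : ℕ × ℕ => v.2.unpair.1 := Primrec.fst.comp (Primrec.unpair.comp Primrec.snd)
  have hs : Computable fun v : ℕ × ℕ => v.2.unpair.2.unpair.1 := (Primrec.fst.comp hu).to_comp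
  have hj : Computable fun v : ℕ × ℕ => v.2.unpair.2.unpair.2 := (Primrec.snd.comp hu).to_comp
  have hst : Computable fun v : ℕ × ℕ =>
      stateAt good v.2.unpair.2.unpair.1 v.2.unpair.2.unpair.2 := (computable_stateAt hg).comp hs hj
  have hend : Computable fun v : ℕ × ℕ => intervalEndAt good v.2.unpair.2.unpair.1
      v.2.unpair.2.unpair.2 (stateAt good v.2.unpair.2.unpair.1 v.2.unpair.2.unpair.2) := by
    refine (computable_intervalEndAt hg).comp (g := fun v : ℕ × ℕ => (v.2.unpair.2.unpair.1,
      v.2.unpair.2.unpair.2, stateAt good v.2.unpair.2.unpair.1 v.2.unpair.2.unpair.2)) ?_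
    exact hs.pair (hj.pair hst)
  have hmem := (Primrec.or.to_comp.comp
    (Primrec.eq.decide.to_comp.comp hi.to_comp (Computable.const 0))
    (Primrec.and.to_comp.comp
      (Primrec.nat_le.decide.to_comp.comp (Computable.fst.comp hst) hi.to_comp)
      (Primrec.nat_lt.decide.to_comp.comp hi.to_comp hend)))
  refine REPred.of_exists_computable (r := fun p c =>
    decide (p = Nat.nth Nat.Prime c.unpair.1) && _) (Computable.to₂ (Primrec.and.to_comp.comp
      (Primrec.eq.decide.to_comp.comp Computable.fst (computable_nth_prime.comp hi.to_comp)) hmem))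
    fun p => ?_
  simp only [Bool.and_eq_true, Bool.or_eq_true, decide_eq_true_eq]
  constructor
  · rintro ⟨i, hi, rfl⟩
    rcases (mem_invertedIndices_iff good).1 hi with rfl | ⟨s, j, h⟩
    · exact ⟨Nat.pair 0 0, by simp⟩
    · exact ⟨Nat.pair i (Nat.pair s j), by simpa using Or.inr h⟩
  · rintro ⟨c, rfl, h⟩
    refine ⟨_, (mem_invertedIndices_iff good).2 ?_, rfl⟩
    rcases h with h | h
    · exact Or.inl h
    · exact Or.inr ⟨_, _, h⟩

theorem Computable₂.partrec_rfind {α : Type*} [Primcodable α] {p : α → ℕ → Bool}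
    (hp : Computable₂ p) : Partrec fun a => Nat.rfind (p a : ℕ →. Bool) :=
  Partrec.rfind hp.partrec

/-- The transition function of the construction, given the information whether requirement `j`
acts. -/
noncomputable def oracleStep (good : ℕ → ℕ → ℕ → Bool) (v : (ℕ × ℕ × ℕ) × ℕ) : Part (ℕ × ℕ) :=
  -- When the requirement does not act, the first alternative stops the search immediately;
  -- otherwise an event is known to exist. With correct information the step converges.
  (Nat.rfind ((fun u => decide (v.2 = 0) || event good v.1.1 v.1.2 u : ℕ → Bool) : ℕ →. Bool)).map
    fun u => nextState v.1.1 (if v.2 = 0 then v.1.2.1 else u + 1) v.1.2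

theorem partrec_oracleStep (hg : Computable fun v : ℕ × ℕ × ℕ => good v.1 v.2.1 v.2.2) :
    Partrec (oracleStep good) := by
  have h0 : Computable fun w : ((ℕ × ℕ × ℕ) × ℕ) × ℕ => event good w.1.1.1 w.1.1.2 w.2 := by
    refine (computable_event hg).comp (g := fun w : ((ℕ × ℕ × ℕ) × ℕ) × ℕ => (w.1.1, w.2)) ?_
    exact (Computable.fst.comp Computable.fst).pair Computable.snd
  have h1 : Computable fun w : ((ℕ × ℕ × ℕ) × ℕ) × ℕ =>
      decide (w.1.2 = 0) || event good w.1.1.1 w.1.1.2 w.2 :=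
    Primrec.or.to_comp.comp
      (Primrec.eq.comp (Primrec.snd.comp Primrec.fst) (Primrec.const 0)).decide.to_comp h0
  have h2 : Primrec fun w : ((ℕ × ℕ × ℕ) × ℕ) × ℕ => if w.1.2 = 0 then w.1.1.2.1 else w.2 + 1 :=
    Primrec.ite (Primrec.eq.comp (Primrec.snd.comp Primrec.fst) (Primrec.const 0))
      (Primrec.fst.comp (Primrec.snd.comp (Primrec.fst.comp Primrec.fst)))
      (Primrec.succ.comp Primrec.snd)
  have h3 : Computable fun w : ((ℕ × ℕ × ℕ) × ℕ) × ℕ =>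
      nextState w.1.1.1 (if w.1.2 = 0 then w.1.1.2.1 else w.2 + 1) w.1.1.2 := by
    refine computable_nextState.comp (g := fun w : ((ℕ × ℕ × ℕ) × ℕ) × ℕ =>
      (w.1.1.1, if w.1.2 = 0 then w.1.1.2.1 else w.2 + 1, w.1.1.2)) ?_
    exact ((Primrec.fst.comp (Primrec.fst.comp Primrec.fst)).pair
      (h2.pair (Primrec.snd.comp (Primrec.fst.comp Primrec.fst)))).to_comp
  have h4 : Partrec fun v : (ℕ × ℕ × ℕ) × ℕ => Nat.rfind
      ((fun u => decide (v.2 = 0) || event good v.1.1 v.1.2 u : ℕ → Bool) : ℕ →. Bool) :=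
    Computable₂.partrec_rfind
      (p := fun (v : (ℕ × ℕ × ℕ) × ℕ) u => decide (v.2 = 0) || event good v.1.1 v.1.2 u) h1.to₂
  exact h4.map (g := fun (v : (ℕ × ℕ × ℕ) × ℕ) (u : ℕ) => nextState v.1.1 (if v.2 = 0 then v.1.2.1 else u + 1) v.1.2) h3.to₂

open Classical in
theorem oracleStep_state (j : ℕ) :
    oracleStep good ((j, state good j), if ∃ c, good j (state good j).2 c = true then 1 else 0) =
      Part.some (state good (j + 1)) := by
  rw [← lt_intervalEnd_iff]
  rcases intervalEnd_cases good j (state good j) with ⟨u, hu, hmin, h, hle⟩ | ⟨-, h⟩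
  · rw [if_pos (by omega)]
    have hr : Nat.rfind ((fun u => decide (1 = 0) || event good j (state good j) u : ℕ → Bool) :
        ℕ →. Bool) = Part.some u :=
      Part.eq_some_iff.2 (Nat.mem_rfind.2 ⟨by simp [hu], fun {v} hv => by simp [hmin v hv]⟩)
    exact ((congrArg (Part.map _) hr).trans (Part.map_some _ _)).trans (by
      rw [state_succ, h]
      rfl)
  · rw [if_neg (by omega)]
    have hr : Nat.rfind ((fun u => decide (0 = 0) || event good j (state good j) u : ℕ → Bool) :
        ℕ →. Bool) = Part.some 0 :=
      Part.eq_some_iff.2 (Nat.mem_rfind.2 ⟨by simp, fun {v} hv => absurd hv (Nat.not_lt_zero v)⟩)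
    exact ((congrArg (Part.map _) hr).trans (Part.map_some _ _)).trans (by
      rw [state_succ, h]
      rfl)

/-- The step may be partial: it has to converge only along the actual sequence. The first component
0 is a dummy parameter of the recursion. -/
theorem Nat.RecursiveIn.of_step {O : Set (ℕ →. ℕ)} {step : ℕ →. ℕ} (hstep : Nat.RecursiveIn O step)
    {P : ℕ → ℕ} (h : ∀ j, step (Nat.pair j (P j)) = Part.some (P (j + 1))) :
    Nat.RecursiveIn O (P : ℕ →. ℕ) := by
  have h1 : Nat.RecursiveIn O fun n => step n.unpair.2 :=
    (hstep.comp Nat.RecursiveIn.right).of_eq fun n => Part.bind_some _ _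
  have h2 := Nat.RecursiveIn.prec (O := O) (f := fun _ => Part.some (P 0))
    (Nat.Primrec.recursiveIn (Nat.Primrec.const (P 0))) h1
  have hp : Nat.RecursiveIn O fun j => (Part.some (Nat.pair 0 j) : Part ℕ) :=
    Nat.Primrec.recursiveIn (_root_.Primrec.nat_iff.1 (Primrec₂.natPair.comp (_root_.Primrec.const 0) _root_.Primrec.id))
  refine (h2.comp hp).of_eq fun j => (Part.bind_some _ _).trans ?_
  simp only [Nat.unpair_pair]
  induction j with
  | zero => rfl
  | succ j ih => exact ((congrArg (fun X => Part.bind X _) ih).trans (Part.bind_some _ _)).trans (h j)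

open Classical in
/-- The construction can be followed with any oracle that tells which requirements act. -/
theorem recursiveIn_state (hg : Computable fun v : ℕ × ℕ × ℕ => good v.1 v.2.1 v.2.2)
    {O : Set (ℕ →. ℕ)} {β : ℕ →. ℕ} (hβ : Nat.RecursiveIn O β)
    (h : ∀ j, β (Nat.pair j (Encodable.encode (state good j))) =
      Part.some (if ∃ c, good j (state good j).2 c = true then 1 else 0)) :
    Nat.RecursiveIn O ((fun j => Encodable.encode (state good j) : ℕ → ℕ) : ℕ →. ℕ) ∧
    Nat.RecursiveIn O
      ((fun j => if ∃ c, good j (state good j).2 c = true then 1 else 0 : ℕ → ℕ) : ℕ →. ℕ) := by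
  have hstep : Nat.Partrec fun n => (oracleStep good (Denumerable.ofNat ((ℕ × ℕ × ℕ) × ℕ) n)).map
      Encodable.encode :=
    Partrec.nat_iff.1 (((partrec_oracleStep hg).comp (Computable.ofNat _)).map
      (Computable.encode.comp Computable.snd).to₂)
  have hid : Nat.RecursiveIn O fun j => (Part.some j : Part ℕ) :=
    Nat.Primrec.recursiveIn Nat.Primrec.id
  have h1 := hstep.recursiveIn.comp (hid.pair hβ)
  have h3 : Nat.RecursiveIn O ((fun j => Encodable.encode (state good j) : ℕ → ℕ) : ℕ →. ℕ) := by
    refine h1.of_step fun j => ?_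
    have h4 : Denumerable.ofNat ((ℕ × ℕ × ℕ) × ℕ) (Nat.pair (Nat.pair j (Encodable.encode (state good j)))
        (if ∃ c, good j (state good j).2 c = true then 1 else 0)) =
        ((j, state good j), if ∃ c, good j (state good j).2 c = true then 1 else 0) :=
      Denumerable.ofNat_encode
        ((j, state good j), if ∃ c, good j (state good j).2 c = true then 1 else 0)
    simp only [h, Part.map_eq_map, Part.map_some, Seq.seq, Part.bind_eq_bind, Part.bind_some, h4,
      oracleStep_state]
  refine ⟨h3, (hβ.comp (hid.pair h3)).of_eq fun j => ?_⟩
  have h5 : (Nat.pair <$> (Part.some j : Part ℕ) <*>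
      (Part.some (Encodable.encode (state good j)) : Part ℕ)) =
      Part.some (Nat.pair j (Encodable.encode (state good j))) := by
    simp only [Seq.seq, Part.map_eq_map, Part.map_some, Part.bind_some]
  exact ((congrArg (fun X => Part.bind X β) h5).trans (Part.bind_some _ _)).trans (h j)

end ConstructionComputable

/-! ### Membership in `ℤ[S⁻¹]` through denominators. -/

section InvertPrimes

theorem Rat.den_inv_natCast {n : ℕ} (hn : n ≠ 0) : ((n : ℚ)⁻¹).den = n := by
  rw [Rat.inv_natCast_den, if_neg hn]

theorem inv_natCast_mem_invertPrimes {S : Set ℕ} {n : ℕ} (hn : n ≠ 0)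
    (h : ∀ p : ℕ, p.Prime → p ∣ n → p ∈ S) : (n : ℚ)⁻¹ ∈ invertPrimes S := by
  induction n using induction_on_primes with
  | zero => exact absurd rfl hn
  | one =>
    rw [Nat.cast_one, inv_one]
    exact one_mem _
  | prime_mul p n hp ih =>
    rw [Nat.cast_mul, mul_inv]
    refine mul_mem (Subring.subset_closure ⟨p, h p hp (Dvd.intro _ rfl), rfl⟩)
      (ih (right_ne_zero_of_mul hn) fun q hq hd => h q hq (hd.mul_left p))

theorem mem_invertPrimes_iff {S : Set ℕ} (hS : ∀ p ∈ S, p.Prime) {x : ℚ} :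
    x ∈ invertPrimes S ↔ ∀ p : ℕ, p.Prime → p ∣ x.den → p ∈ S := by
  constructor
  · intro hx
    induction hx using Subring.closure_induction with
    | mem x hx =>
      obtain ⟨q, hq, rfl⟩ := hx
      intro p hp hd
      simp only at hd
      rw [Rat.den_inv_natCast (hS q hq).ne_zero, Nat.prime_dvd_prime_iff_eq hp (hS q hq)] at hd
      rwa [hd]
    | zero => exact fun p hp hd => absurd hd hp.not_dvd_one
    | one => exact fun p hp hd => absurd hd hp.not_dvd_one
    | add x y _ _ hx hy =>
      intro p hp hd
      exact (hp.dvd_mul.1 (hd.trans (Rat.add_den_dvd x y))).elim (hx p hp) (hy p hp)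
    | neg x _ hx => exact hx
    | mul x y _ _ hx hy =>
      intro p hp hd
      exact (hp.dvd_mul.1 (hd.trans (Rat.mul_den_dvd x y))).elim (hx p hp) (hy p hp)
  · intro h
    rw [← Rat.num_div_den x, div_eq_mul_inv]
    exact mul_mem (intCast_mem _ _) (inv_natCast_mem_invertPrimes x.den_ne_zero h)

theorem inv_prime_mem_invertPrimes_iff {S : Set ℕ} (hS : ∀ p ∈ S, p.Prime) {p : ℕ} (hp : p.Prime) :
    (p : ℚ)⁻¹ ∈ invertPrimes S ↔ p ∈ S := by
  rw [mem_invertPrimes_iff hS, Rat.den_inv_natCast hp.ne_zero]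
  refine ⟨fun h => h p hp dvd_rfl, fun h q hq hd => ?_⟩
  rwa [(Nat.prime_dvd_prime_iff_eq hq hp).1 hd]

end InvertPrimes

/-! ### Computable presentations. -/

section Presentation

/-- Keeping only the first name of every element leaves a decidable infinite set of names, which is
renumbered by ℕ in increasing order. -/
theorem computablyPresentable_of_surjective {R : Type*} [CommRing R] [Infinite R] {h : ℕ → R}
    (hsurj : Function.Surjective h) (heq : PrimrecRel fun i j => h i = h j)
    {f g : ℕ → ℕ → ℕ} (hf : Computable₂ f) (hfh : ∀ i j, h (f i j) = h i + h j)
    (hg : Computable₂ g) (hgh : ∀ i j, h (g i j) = h i * h j) : ComputablyPresentable R := by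
  classical
  let P : ℕ → Prop := fun k => ∀ j < k, ¬ h j = h k
  have hP : PrimrecPred P := heq.not.forall_lt_of Primrec.id
  have hspec : ∀ x, h (Nat.find (hsurj x)) = x := fun x => Nat.find_spec (hsurj x)
  have hPfind : ∀ x, P (Nat.find (hsurj x)) := fun x j hj => by
    rw [hspec]
    exact Nat.find_min (hsurj x) hj
  have hfind : ∀ k, P k → Nat.find (hsurj (h k)) = k := fun k hk =>
    (Nat.find_eq_iff _).2 ⟨rfl, hk⟩
  have hinf : (Set.ofPred P).Infinite := by
    intro hfin
    have : (Set.univ : Set R) ⊆ h '' Set.ofPred P := fun x _ =>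
      ⟨Nat.find (hsurj x), hPfind x, hspec x⟩
    exact Set.infinite_univ ((hfin.image h).subset this)
  let φ : R ≃ ℕ :=
    { toFun := fun x => Nat.count P (Nat.find (hsurj x))
      invFun := fun n => h (Nat.nth P n)
      left_inv := fun x => (congrArg h (Nat.nth_count (hPfind x))).trans (hspec x)
      right_inv := fun n => (congrArg (Nat.count P) (hfind _ (Nat.nth_mem_of_infinite hinf n))).trans
        (Nat.count_nth_of_infinite hinf n) }
  have hfirst : Computable fun i => Nat.find (hsurj (h i)) :=
    Computable.find (P := fun i k => h k = h i)
      (heq.comp Primrec.snd Primrec.fst).computablePred fun i => hsurj (h i)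
  have hnth := hP.computablePred.computable_nth hinf
  have hcount := hP.computablePred.computable_count
  have main : ∀ F : ℕ → ℕ → ℕ, Computable₂ F →
      Computable₂ fun a b => φ (h (F (Nat.nth P a) (Nat.nth P b))) := fun F hF =>
    (hcount.comp (hfirst.comp (hF.comp (hnth.comp Computable.fst) (hnth.comp Computable.snd)))).to₂
  exact ⟨φ, (main f hf).of_eq fun v => congrArg φ (hfh _ _),
    (main g hg).of_eq fun v => congrArg φ (hgh _ _)⟩

/-- The fraction with numerator and denominator coded by `c`, where the denominator is a product of
values of `d`. -/
def fractionOfCode (d : ℕ → ℕ) (c : ℕ) : ℤ × ℕ :=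
  ((Denumerable.ofNat (ℤ × List ℕ) c).1, ((Denumerable.ofNat (ℤ × List ℕ) c).2.map d).prod)

theorem fractionOfCode_encode (d : ℕ → ℕ) (z : ℤ) (L : List ℕ) :
    fractionOfCode d (Encodable.encode (z, L)) = (z, (L.map d).prod) := by
  rw [fractionOfCode, Denumerable.ofNat_encode]

theorem primrec_fractionOfCode {d : ℕ → ℕ} (hd : Primrec d) : Primrec (fractionOfCode d) :=
  have h : Primrec (Denumerable.ofNat (ℤ × List ℕ)) := Primrec.ofNat _
  (Primrec.fst.comp h).pair
    (Primrec.list_prod_nat.comp (Primrec.list_map (Primrec.snd.comp h) (hd.comp Primrec.snd).to₂))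

theorem computablyPresentable_invertPrimes {S : Set ℕ} (hS : ∀ p ∈ S, p.Prime) (hne : S.Nonempty)
    (hce : IsCE S) : ComputablyPresentable (invertPrimes S) := by
  obtain ⟨r, hr, hrS⟩ := hce.exists_primrec
  obtain ⟨p₀, hp₀⟩ := hne
  -- A primitive recursive enumeration of `S`; pairs that witness nothing are filled with `p₀`.
  let d : ℕ → ℕ := fun k => if r k.unpair.1 k.unpair.2 = true then k.unpair.1 else p₀
  have hdS : ∀ k, d k ∈ S := fun k => by
    simp only [d]
    split_ifs with h
    · exact (hrS _).2 ⟨_, h⟩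
    · exact hp₀
  have hdsurj : ∀ p ∈ S, ∃ k, d k = p := fun p hp => by
    obtain ⟨c, hc⟩ := (hrS p).1 hp
    exact ⟨Nat.pair p c, by simp [d, hc]⟩
  have hd : Primrec d :=
    Primrec.ite (Primrec.eq.comp (hr.comp (Primrec.fst.comp Primrec.unpair)
      (Primrec.snd.comp Primrec.unpair)) (Primrec.const true))
      (Primrec.fst.comp Primrec.unpair) (Primrec.const p₀)
  have hpos : ∀ L : List ℕ, (L.map d).prod ≠ 0 := fun L h0 => by
    obtain ⟨k, -, hk⟩ := List.mem_map.1 (List.prod_eq_zero_iff.1 h0)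
    exact (hS _ (hdS k)).ne_zero hk
  have hpos' : ∀ c, (fractionOfCode d c).2 ≠ 0 := fun c => hpos _
  have hmem : ∀ c, ((fractionOfCode d c).1 : ℚ) / (fractionOfCode d c).2 ∈ invertPrimes S := by
    intro c
    rw [div_eq_mul_inv]
    refine mul_mem (intCast_mem _ _) (inv_natCast_mem_invertPrimes (hpos' c) fun p hp hd => ?_)
    obtain ⟨q, hq, hpq⟩ := (Prime.dvd_prod_iff hp.prime).1 hd
    obtain ⟨k, -, rfl⟩ := List.mem_map.1 hq
    rw [(Nat.prime_dvd_prime_iff_eq hp (hS _ (hdS k))).1 hpq]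
    exact hdS k
  let h : ℕ → invertPrimes S := fun c => ⟨_, hmem c⟩
  have hval : ∀ c, (h c : ℚ) = ((fractionOfCode d c).1 : ℚ) / (fractionOfCode d c).2 := fun _ => rfl
  have hsurj : Function.Surjective h := by
    rintro ⟨x, hx⟩
    have hx' := (mem_invertPrimes_iff hS).1 hx
    have hL : x.den.primeFactorsList ∈ Set.range (List.map d) := by
      rw [Set.range_list_map]
      exact fun p hp => hdsurj p
        (hx' p (Nat.prime_of_mem_primeFactorsList hp) (Nat.dvd_of_mem_primeFactorsList hp))
    obtain ⟨L, hL⟩ := hL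
    refine ⟨Encodable.encode (x.num, L), Subtype.ext ?_⟩
    rw [hval, fractionOfCode_encode, hL, Nat.prod_primeFactorsList x.den_ne_zero]
    exact Rat.num_div_den x
  have hF := primrec_fractionOfCode hd
  -- Equality is decided by cross-multiplication, without deciding membership in `S`.
  have heq : PrimrecRel fun i j => h i = h j := by
    refine (Primrec.eq.comp
      (Primrec.int_mul.comp (Primrec.fst.comp (hF.comp Primrec.fst))
        (Primrec.int_natCast.comp (Primrec.snd.comp (hF.comp Primrec.snd))))
      (Primrec.int_mul.comp (Primrec.fst.comp (hF.comp Primrec.snd))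
        (Primrec.int_natCast.comp (Primrec.snd.comp (hF.comp Primrec.fst))))).of_eq fun v => ?_
    have h1 : ((fractionOfCode d v.1).2 : ℚ) ≠ 0 := by exact_mod_cast hpos' v.1
    have h2 : ((fractionOfCode d v.2).2 : ℚ) ≠ 0 := by exact_mod_cast hpos' v.2
    show _ ↔ h v.1 = h v.2
    rw [← Subtype.coe_inj, hval, hval, div_eq_div_iff h1 h2]
    norm_cast
  have hD : Primrec (Denumerable.ofNat (ℤ × List ℕ)) := Primrec.ofNat _
  have happ : Primrec fun v : ℕ × ℕ =>
      (Denumerable.ofNat (ℤ × List ℕ) v.1).2 ++ (Denumerable.ofNat (ℤ × List ℕ) v.2).2 :=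
    Primrec.list_append.comp (Primrec.snd.comp (hD.comp Primrec.fst))
      (Primrec.snd.comp (hD.comp Primrec.snd))
  have happd : ∀ i j, (((Denumerable.ofNat (ℤ × List ℕ) i).2 ++
      (Denumerable.ofNat (ℤ × List ℕ) j).2).map d).prod =
      (fractionOfCode d i).2 * (fractionOfCode d j).2 := fun i j => by
    rw [List.map_append, List.prod_append]
    rfl
  have hf : Primrec₂ fun i j => Encodable.encode
      ((fractionOfCode d i).1 * (fractionOfCode d j).2 + (fractionOfCode d j).1 * (fractionOfCode d i).2,
        (Denumerable.ofNat (ℤ × List ℕ) i).2 ++ (Denumerable.ofNat (ℤ × List ℕ) j).2) :=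
    Primrec.encode.comp ((Primrec.int_add.comp
      (Primrec.int_mul.comp (Primrec.fst.comp (hF.comp Primrec.fst))
        (Primrec.int_natCast.comp (Primrec.snd.comp (hF.comp Primrec.snd))))
      (Primrec.int_mul.comp (Primrec.fst.comp (hF.comp Primrec.snd))
        (Primrec.int_natCast.comp (Primrec.snd.comp (hF.comp Primrec.fst))))).pair happ)
  have hg : Primrec₂ fun i j => Encodable.encode
      ((fractionOfCode d i).1 * (fractionOfCode d j).1,
        (Denumerable.ofNat (ℤ × List ℕ) i).2 ++ (Denumerable.ofNat (ℤ × List ℕ) j).2) :=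
    Primrec.encode.comp ((Primrec.int_mul.comp (Primrec.fst.comp (hF.comp Primrec.fst))
      (Primrec.fst.comp (hF.comp Primrec.snd))).pair happ)
  refine computablyPresentable_of_surjective hsurj heq hf.to_comp (fun i j => Subtype.ext ?_)
    hg.to_comp (fun i j => Subtype.ext ?_)
  all_goals
    have h1 : ((fractionOfCode d i).2 : ℚ) ≠ 0 := by exact_mod_cast hpos' i
    have h2 : ((fractionOfCode d j).2 : ℚ) ≠ 0 := by exact_mod_cast hpos' j
  · rw [Subring.coe_add, hval, hval, hval, fractionOfCode_encode, happd]
    push_cast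
    field_simp
  · rw [Subring.coe_mul, hval, hval, hval, fractionOfCode_encode, happd]
    push_cast
    field_simp

end Presentation

/-! ### Turing reductions between sets. -/

section OracleReductions

theorem Computable.nat_recursiveIn {O : Set (ℕ →. ℕ)} {f : ℕ → ℕ} (hf : Computable f) :
    Nat.RecursiveIn O (f : ℕ →. ℕ) :=
  (Partrec.nat_iff.1 hf.partrec).recursiveIn

theorem Nat.RecursiveIn.total_comp {O : Set (ℕ →. ℕ)} {f g : ℕ → ℕ}
    (hf : Nat.RecursiveIn O (f : ℕ →. ℕ)) (hg : Nat.RecursiveIn O (g : ℕ →. ℕ)) :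
    Nat.RecursiveIn O ((fun n => f (g n) : ℕ → ℕ) : ℕ →. ℕ) :=
  (hf.comp hg).of_eq fun _ => Part.bind_some _ _

theorem Nat.RecursiveIn.total_pair {O : Set (ℕ →. ℕ)} {f g : ℕ → ℕ}
    (hf : Nat.RecursiveIn O (f : ℕ →. ℕ)) (hg : Nat.RecursiveIn O (g : ℕ →. ℕ)) :
    Nat.RecursiveIn O ((fun n => Nat.pair (f n) (g n) : ℕ → ℕ) : ℕ →. ℕ) :=
  (hf.pair hg).of_eq fun n => by
    simp only [Seq.seq, PFun.coe_val, Part.map_eq_map, Part.map_some, Part.bind_some]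

/-- Both branches are total, so both are computed and one is selected primitive recursively. -/
theorem Nat.RecursiveIn.total_ite {O : Set (ℕ →. ℕ)} {c : ℕ → Prop} [DecidablePred c] {f g : ℕ → ℕ}
    (hc : PrimrecPred c) (hf : Nat.RecursiveIn O (f : ℕ →. ℕ))
    (hg : Nat.RecursiveIn O (g : ℕ →. ℕ)) :
    Nat.RecursiveIn O ((fun n => if c n then f n else g n : ℕ → ℕ) : ℕ →. ℕ) := by
  have h1 : _root_.Primrec fun n : ℕ => n.unpair.2.unpair :=
    Primrec.unpair.comp (Primrec.snd.comp Primrec.unpair)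
  have h2 : _root_.Primrec fun n : ℕ =>
      if c n.unpair.1 then n.unpair.2.unpair.1 else n.unpair.2.unpair.2 :=
    Primrec.ite (hc.comp (Primrec.fst.comp Primrec.unpair)) (Primrec.fst.comp h1)
      (Primrec.snd.comp h1)
  have h3 := h2.to_comp.nat_recursiveIn.total_comp
    ((Computable.id.nat_recursiveIn (O := O)).total_pair (hf.total_pair hg))
  refine h3.of_eq fun n => ?_
  simp [Nat.unpair_pair]

theorem setTuringLE_iff {C B : Set ℕ} :
    SetTuringLE C B ↔ Nat.RecursiveIn {charFun B} (charFun C) :=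
  RecursiveIn.iff_nat

theorem SetTuringLE.trans {A B C : Set ℕ} (h₁ : SetTuringLE A B) (h₂ : SetTuringLE B C) :
    SetTuringLE A C :=
  TuringReducible.trans h₁ h₂

theorem SetTuringLE.refl (A : Set ℕ) : SetTuringLE A A :=
  TuringReducible.refl _

theorem recursiveIn_charFun (B : Set ℕ) :
    Nat.RecursiveIn {charFun B} ((B.indicator 1 : ℕ → ℕ) : ℕ →. ℕ) :=
  setTuringLE_iff.1 (SetTuringLE.refl B)

theorem setTuringLE_of_total {C B : Set ℕ} {f : ℕ → ℕ}
    (hf : Nat.RecursiveIn {charFun B} (f : ℕ →. ℕ)) (h : ∀ n, f n = C.indicator 1 n) :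
    SetTuringLE C B :=
  setTuringLE_iff.2 (hf.of_eq fun n => congrArg Part.some (h n))

open Classical in
theorem indicator_one_eq_ite (A : Set ℕ) (n : ℕ) :
    A.indicator (1 : ℕ → ℕ) n = if n ∈ A then 1 else 0 :=
  Set.indicator_apply _ _ _

theorem indicator_one_congr {A B : Set ℕ} {m n : ℕ} (h : m ∈ A ↔ n ∈ B) :
    A.indicator (1 : ℕ → ℕ) m = B.indicator 1 n := by
  classical
  rw [indicator_one_eq_ite, indicator_one_eq_ite]
  exact if_congr h rfl rfl

theorem setTuringLE_of_computable {A B : Set ℕ} {f : ℕ → ℕ} (hf : Computable f)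
    (h : ∀ n, n ∈ A ↔ f n ∈ B) : SetTuringLE A B :=
  setTuringLE_of_total ((recursiveIn_charFun B).total_comp hf.nat_recursiveIn)
    fun n => indicator_one_congr (h n).symm

end OracleReductions

/-! ### The reductions `S ≤ R ≤ HTP(R)` and enumerability of `HTP ℚ`. -/

section Subrings

theorem ratOfIndex_encode (z : ℤ) (d : ℕ) : ratOfIndex (Encodable.encode (z, d)) = z / (d + 1) := by
  rw [ratOfIndex, Denumerable.ofNat_encode]

theorem setTuringLE_memberSet {S : Set ℕ} (hS : ∀ p ∈ S, p.Prime) :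
    SetTuringLE S (memberSet (invertPrimes S)) := by
  -- The index of `1 / p`; the coding adds 1 to the second entry, hence `p - 1`.
  have h1 : Primrec fun p : ℕ => Encodable.encode ((1 : ℤ), p - 1) :=
    Primrec.encode.comp ((Primrec.const 1).pair (Primrec.nat_sub.comp Primrec.id (Primrec.const 1)))
  refine setTuringLE_of_total (Nat.RecursiveIn.total_ite Primrec.nat_prime
    ((recursiveIn_charFun _).total_comp h1.to_comp.nat_recursiveIn)
    (Computable.const 0).nat_recursiveIn) fun p => ?_
  split_ifs with hp
  · refine indicator_one_congr ?_
    rw [memberSet, Set.mem_ofPred_eq, ratOfIndex_encode, Nat.cast_sub hp.one_le,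
      ← inv_prime_mem_invertPrimes_iff hS hp]
    simp
  · exact (Set.indicator_of_notMem (fun h => hp (hS p h)) _).symm

theorem memberSet_setTuringLE_HTP (R : Subring ℚ) : SetTuringLE (memberSet R) (HTP R) := by
  have hD : Primrec (Denumerable.ofNat (ℤ × ℕ)) := Primrec.ofNat _
  -- The polynomial `(d + 1) X₀ - z`, whose only root is the rational number with index `n`.
  have h1 : Primrec fun n : ℕ => Encodable.encode
      [((((Denumerable.ofNat (ℤ × ℕ) n).2 + 1 : ℕ) : ℤ), [0]),
        (-(Denumerable.ofNat (ℤ × ℕ) n).1, ([] : List ℕ))] :=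
    Primrec.encode.comp (Primrec.list_pair
      ((Primrec.int_natCast.comp (Primrec.succ.comp (Primrec.snd.comp hD))).pair (Primrec.const [0]))
      ((Primrec.int_neg.comp (Primrec.fst.comp hD)).pair (Primrec.const [])))
  refine setTuringLE_of_computable h1.to_comp fun n => ?_
  rw [mem_HTP_subring, termsOfIndex, Denumerable.ofNat_encode, memberSet, Set.mem_ofPred_eq, ratOfIndex]
  generalize (Denumerable.ofNat (ℤ × ℕ) n).1 = z
  generalize (Denumerable.ofNat (ℤ × ℕ) n).2 = d
  have hd : ((d : ℚ) + 1) ≠ 0 := by positivity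
  have h : ∀ x : ℕ → ℚ, evalTerms [(((d + 1 : ℕ) : ℤ), [0]), (-z, [])] x = 0 ↔
      x 0 = z / (d + 1) := fun x => by
    rw [evalTerms_cons, evalTerms_cons, evalTerms_nil, eq_div_iff hd]
    push_cast
    simp only [List.map_cons, List.map_nil, List.prod_cons, List.prod_nil]
    constructor <;> intro h <;> linarith
  simp only [h]
  exact ⟨fun hx => ⟨fun _ => z / (d + 1), fun _ => hx, rfl⟩, fun ⟨x, hx, h0⟩ => h0 ▸ hx 0⟩

/-- Zero codes for `a = 1` put no restriction on the denominators and can be searched through. -/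
theorem isCE_HTP_rat : IsCE (HTP ℚ) := by
  classical
  have hp : Primrec fun v : ℕ × ℕ => decide (IsZeroCode v.1 1 v.2) :=
    (primrec_isZeroCode.comp (Primrec.fst.pair ((Primrec.const 1).pair Primrec.snd))).decide
  refine REPred.of_exists_computable (r := fun e c => decide (IsZeroCode e 1 c)) hp.to_comp.to₂
    fun e => ?_
  simp only [decide_eq_true_eq]
  rw [mem_HTP_rat]
  constructor
  · rintro ⟨x, hx⟩
    exact exists_isZeroCode (fun i => Nat.coprime_one_right _) hx
  · rintro ⟨c, hc⟩
    obtain ⟨x, -, hx⟩ := hc.exists_zero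
    exact ⟨x, hx⟩

end Subrings

/-! ### The requirements and the cycle of reductions. -/

section MainConstruction

open Classical in
/-- Requirement `2 * n` waits for `n` to enter the set enumerated by `r`, and requirement `2 * e + 1`
waits for a zero of the polynomial with index `e` whose denominators avoid the protected primes. -/
noncomputable def mainRequirement (r : ℕ → ℕ → Bool) (j a c : ℕ) : Bool :=
  if j % 2 = 0 then r (j / 2) c else decide (IsZeroCode (j / 2) a c)

variable {r : ℕ → ℕ → Bool}

theorem computable_mainRequirement (hr : Primrec₂ r) :
    Computable fun v : ℕ × ℕ × ℕ => mainRequirement r v.1 v.2.1 v.2.2 := by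
  classical
  have h2 : Primrec fun v : ℕ × ℕ × ℕ => v.1 / 2 :=
    Primrec.nat_div.comp Primrec.fst (Primrec.const 2)
  have hz : Primrec fun v : ℕ × ℕ × ℕ => decide (IsZeroCode (v.1 / 2) v.2.1 v.2.2) :=
    (primrec_isZeroCode.comp (h2.pair Primrec.snd)).decide
  have hm : PrimrecPred fun v : ℕ × ℕ × ℕ => v.1 % 2 = 0 :=
    Primrec.eq.comp (Primrec.nat_mod.comp Primrec.fst (Primrec.const 2)) (Primrec.const 0)
  refine ((Primrec.ite hm (hr.comp h2 (Primrec.snd.comp Primrec.snd)) hz).of_eq fun v => ?_).to_comp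
  unfold mainRequirement
  split_ifs <;> rfl

theorem mainRequirement_even (n a c : ℕ) : mainRequirement r (2 * n) a c = r n c := by
  rw [mainRequirement, if_pos (by omega), Nat.mul_div_cancel_left n two_pos]

theorem mainRequirement_odd (e a c : ℕ) :
    mainRequirement r (2 * e + 1) a c = true ↔ IsZeroCode e a c := by
  classical
  rw [mainRequirement, if_neg (by omega), decide_eq_true_eq, show (2 * e + 1) / 2 = e by omega]

/-- If the requirement acts, all unprotected primes that can occur in the denominators of its zero
become inverted. Conversely a zero in the ring has denominators prime to the protected product, so
some code is eventually found. -/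
theorem exists_mainRequirement_odd_iff (e : ℕ) :
    (∃ c, mainRequirement r (2 * e + 1) (state (mainRequirement r) (2 * e + 1)).2 c = true) ↔
      e ∈ HTP (invertPrimes (invertedPrimes (mainRequirement r))) := by
  have hS : ∀ p ∈ invertedPrimes (mainRequirement r), p.Prime :=
    fun _ => prime_of_mem_invertedPrimes _
  rw [mem_HTP_subring]
  constructor
  · intro h
    obtain ⟨c, hc, hmem⟩ := exists_good_of_mem _ h
    rw [mainRequirement_odd] at hc
    obtain ⟨x, hx, h0⟩ := hc.exists_zero
    refine ⟨x, fun i => (mem_invertPrimes_iff hS).2 fun p hp hd => ?_, h0⟩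
    obtain ⟨k, rfl⟩ := exists_nth_prime_eq hp
    refine (nth_prime_mem_invertedPrimes _).2 (hmem k ?_ fun hdvd => ?_)
    -- The prime with index `k` is at least `k + 2` and at most `c + 1`, so `k ≤ c`.
    · have h1 := Nat.le_of_dvd (x i).den_pos hd
      have h2 := (hx i).2
      have h3 := Nat.add_two_le_nth_prime k
      omega
    · exact hp.one_lt.ne' (Nat.eq_one_of_dvd_coprimes (hx i).1 hd hdvd)
  · rintro ⟨x, hx, h0⟩
    obtain ⟨c, hc⟩ := exists_isZeroCode (a := (state (mainRequirement r) (2 * e + 1)).2)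
      (fun i => coprime_of_forall_nth_prime fun k hk hd => ((nth_prime_dvd_state_iff _).1 hd).2
        ((nth_prime_mem_invertedPrimes _).1
          ((mem_invertPrimes_iff hS).1 (hx i) _ (Nat.prime_nth_prime k) hk))) h0
    exact ⟨c, (mainRequirement_odd _ _ _).2 hc⟩

theorem primrec_state_of_pair :
    Primrec fun n : ℕ => Denumerable.ofNat (ℕ × ℕ) n.unpair.2 :=
  (Primrec.ofNat _).comp (Primrec.snd.comp Primrec.unpair)

/-- The oracle `B` answers even requirements directly and odd ones through the semilocal reduction
to `HTP ℚ`, which applies because the protected product is odd and squarefree. -/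
theorem HTP_setTuringLE {B : Set ℕ} (hr : Primrec₂ r) (hB : ∀ n, n ∈ B ↔ ∃ c, r n c = true)
    (hle : SetTuringLE (HTP ℚ) B) :
    SetTuringLE (HTP (invertPrimes (invertedPrimes (mainRequirement r)))) B := by
  classical
  obtain ⟨g, hg, hgspec⟩ := exists_computable_semilocal_reduction
  have hj : Primrec fun n : ℕ => n.unpair.1 := Primrec.fst.comp Primrec.unpair
  have hj2 : Primrec fun n : ℕ => n.unpair.1 / 2 := Primrec.nat_div.comp hj (Primrec.const 2)
  have hga : Computable fun n : ℕ =>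
      g (n.unpair.1 / 2) (Denumerable.ofNat (ℕ × ℕ) n.unpair.2).2 :=
    hg.comp hj2.to_comp (Primrec.snd.comp primrec_state_of_pair).to_comp
  have hβ := Nat.RecursiveIn.total_ite (O := {charFun B}) (c := fun n => n.unpair.1 % 2 = 0)
    (Primrec.eq.comp (Primrec.nat_mod.comp hj (Primrec.const 2)) (Primrec.const 0))
    ((recursiveIn_charFun B).total_comp hj2.to_comp.nat_recursiveIn)
    (Nat.RecursiveIn.total_comp (setTuringLE_iff.1 hle) hga.nat_recursiveIn)
  have h := (recursiveIn_state (computable_mainRequirement hr) hβ fun j => ?_).2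
  · refine setTuringLE_of_total (h.total_comp
      (f := fun j => if ∃ c, mainRequirement r j (state (mainRequirement r) j).2 c = true then 1 else 0)
      (Primrec.succ.comp (Primrec.nat_mul.comp (Primrec.const 2) Primrec.id)).to_comp.nat_recursiveIn)
      fun e => ?_
    rw [indicator_one_eq_ite]
    exact if_congr (exists_mainRequirement_odd_iff e) rfl rfl
  · refine congrArg Part.some ?_
    simp only [Nat.unpair_pair, Denumerable.ofNat_encode, indicator_one_eq_ite]
    rcases Nat.even_or_odd' j with ⟨n, rfl | rfl⟩
    · rw [if_pos (by omega), Nat.mul_div_cancel_left n two_pos]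
      simp only [mainRequirement_even]
      exact if_congr (hB n) rfl rfl
    · rw [if_neg (by omega), show (2 * n + 1) / 2 = n by omega]
      simp only [mainRequirement_odd]
      exact if_congr (hgspec _ _ (odd_state _ _) (squarefree_state _ _)) rfl rfl

/-- Given the state, `S` answers whether the requirement acts by whether the first undecided prime
is inverted; even requirements then decide `B`. -/
theorem setTuringLE_invertedPrimes {B : Set ℕ} (hr : Primrec₂ r)
    (hB : ∀ n, n ∈ B ↔ ∃ c, r n c = true) :
    SetTuringLE B (invertedPrimes (mainRequirement r)) := by
  classical
  have hβ := (recursiveIn_charFun (invertedPrimes (mainRequirement r))).total_comp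
    (computable_nth_prime.comp (Primrec.fst.comp primrec_state_of_pair).to_comp).nat_recursiveIn
  have h := (recursiveIn_state (computable_mainRequirement hr) hβ fun j => ?_).2
  · refine setTuringLE_of_total (h.total_comp
      (f := fun j => if ∃ c, mainRequirement r j (state (mainRequirement r) j).2 c = true then 1 else 0)
      (Primrec.nat_mul.comp (Primrec.const 2) Primrec.id).to_comp.nat_recursiveIn)
      fun n => ?_
    simp only [indicator_one_eq_ite, mainRequirement_even]
    exact if_congr (hB n).symm rfl rfl
  · refine congrArg Part.some ?_
    simp only [Nat.unpair_pair, Denumerable.ofNat_encode, indicator_one_eq_ite]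
    exact if_congr ((nth_prime_mem_invertedPrimes _).trans (state_mem_invertedIndices_iff _)) rfl rfl

/-- The four reductions form the cycle `S ≤ R ≤ HTP(R) ≤ B ≤ S`, from which all the equivalences
follow. -/
theorem exists_set_of_primes {B : Set ℕ} (hB : IsCE B) (hle : SetTuringLE (HTP ℚ) B) :
    ∃ S : Set ℕ, (∀ p ∈ S, p.Prime) ∧ IsCE S ∧ lowerDensity S = 0 ∧
      ComputablyPresentable (invertPrimes S) ∧ SetTuringLE S (memberSet (invertPrimes S)) ∧
      SetTuringLE (memberSet (invertPrimes S)) (HTP (invertPrimes S)) ∧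
      SetTuringLE (HTP (invertPrimes S)) B ∧ SetTuringLE B S := by
  obtain ⟨r, hr, hrB⟩ := hB.exists_primrec
  have hS : ∀ p ∈ invertedPrimes (mainRequirement r), p.Prime :=
    fun _ => prime_of_mem_invertedPrimes _
  have hce := isCE_invertedPrimes (computable_mainRequirement hr)
  exact ⟨invertedPrimes (mainRequirement r), hS, hce, lowerDensity_invertedPrimes _,
    computablyPresentable_invertPrimes hS ⟨_, (nth_prime_mem_invertedPrimes _).2 (Or.inl rfl)⟩ hce,
    setTuringLE_memberSet hS, memberSet_setTuringLE_HTP _, HTP_setTuringLE hr hrB hle,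
    setTuringLE_invertedPrimes hr hrB⟩

end MainConstruction

theorem mainTheorem2 :
    (∀ B : Set ℕ, IsCE B → SetTuringLE (HTP ℚ) B →
      ∃ S : Set ℕ, (∀ p ∈ S, p.Prime) ∧ IsCE S ∧ lowerDensity S = 0 ∧
        ComputablyPresentable (invertPrimes S) ∧
        SetTuringEquiv S (HTP (invertPrimes S)) ∧
        SetTuringEquiv (HTP (invertPrimes S)) B) ∧
    (∃ S : Set ℕ, (∀ p ∈ S, p.Prime) ∧ IsCE S ∧ lowerDensity S = 0 ∧
        ComputablyPresentable (invertPrimes S) ∧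
        SetTuringEquiv (memberSet (invertPrimes S)) (HTP (invertPrimes S)) ∧
        SetTuringEquiv (HTP (invertPrimes S)) (HTP ℚ)) := by
  constructor
  · intro B hB hle
    obtain ⟨S, h1, h2, h3, h4, h5, h6, h7, h8⟩ := exists_set_of_primes hB hle
    exact ⟨S, h1, h2, h3, h4, ⟨h5.trans h6, h7.trans h8⟩, h7, h8.trans (h5.trans h6)⟩
  -- The case `B = HTP ℚ`.
  · obtain ⟨S, h1, h2, h3, h4, h5, h6, h7, h8⟩ :=
      exists_set_of_primes isCE_HTP_rat (SetTuringLE.refl _)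
    exact ⟨S, h1, h2, h3, h4, ⟨h6, h7.trans (h8.trans h5)⟩, h7, h8.trans (h5.trans h6)⟩
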